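/- Consider the agent-moving model: there are $n\ge 1$ agents and $n$ objects, every agent $a$ has a strict linear preference order $\succ_a$ over the objects, and the objects are the vertices of an undirected graph. A (perfect) matching is a bijection from agents to objects. Given a matching $\mu$, two agents $a,a'$ may swap their objects if $\mu(a)$ and $\mu(a')$ are adjacent in the graph, $\mu(a')\succ_a\mu(a)$ and $\mu(a)\succ_{a'}\mu(a')$. For an initial matching $\mu_0$, let $\mathrm{Reach}(\mu_0)$ be the set of all matchings obtainable from $\mu_0$ by a finite (possibly empty) sequence of swaps. A matching $\mu\in\mathrm{Reach}(\mu_0)$ is Pareto-efficient if no $\mu'\in\mathrm{Reach}(\mu_0)$ Pareto-dominates it, i.e. makes some agent strictly better off and no agent worse off than $\mu$. **Theorem.** Pareto-efficient matching on paths can be solved in $O(n^2)$ time. That is, there are a single algorithm (a word-RAM program with unit-cost operations on words of $O(\log n)$ bits) and a constant $C$ such that for every $n\ge1$, given as input the $n$ preference lists, a graph on the objects (by its adjacency matrix) that is a path on all $n$ objects, and an initial matching $\mu_0$, the algorithm outputs, after at most $Cn^2$ steps, a Pareto-efficient matching $\mu\in\mathrm{Reach}(\mu_0)$. Moreover, the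 computed matching $\mu$ is the outcome of serial dictatorship along the path: if $b_1,\dots,b_n$ are the objects in the order in which they occur on the path (for one of its two directions) and $a_k=\mu_0^{-1}(b_k)$, then for every $k$, $\mu(a_k)$ is the object most preferred by $a_k$ among all $\nu(a_k)$ with $\nu\in\mathrm{Reach}(\mu_0)$ and $\nu(a_j)=\mu(a_j)$ for all $j<k$. -/

import Mathlib

/-! ### The agent-moving model -/

/-- An object allocation framework: equally many agents and objects, a strict linear preference
order of every agent over the objects (`pref a b b'` reads: `a` prefers `b` to `b'`), and an
undirected graph on the objects. -/
structure OAF (A B : Type*) [Fintype A] [Fintype B] where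
  card_eq : Fintype.card A = Fintype.card B
  pref : A → B → B → Prop
  pref_strict : ∀ a, IsStrictTotalOrder B (pref a)
  graph : SimpleGraph B

namespace OAF

variable {A B : Type*} [Fintype A] [Fintype B]

/-- A perfect matching of agents and objects is a bijection. `F.Swap μ μ'` says that `μ'` results
from `μ` when two agents matched to adjacent objects, each of which prefers the object of the
other, exchange their objects. -/
def Swap (F : OAF A B) (μ μ' : A ≃ B) : Prop :=
  ∃ a a' : A, F.graph.Adj (μ a) (μ a') ∧
    F.pref a (μ a') (μ a) ∧ F.pref a' (μ a) (μ a') ∧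
    μ' a = μ a' ∧ μ' a' = μ a ∧ ∀ x, x ≠ a → x ≠ a' → μ' x = μ x

/-- The set of perfect matchings obtained from `μ₀` by a finite (possibly empty) sequence of
swaps. -/
def reach (F : OAF A B) (μ₀ : A ≃ B) : Set (A ≃ B) :=
  {μ | Relation.ReflTransGen F.Swap μ₀ μ}

/-- `μ'` Pareto-dominates `μ`: no agent is worse off in `μ'`, and some agent is better off. -/
def Dominates (F : OAF A B) (μ' μ : A ≃ B) : Prop :=
  (∀ a, μ' a = μ a ∨ F.pref a (μ' a) (μ a)) ∧ ∃ a, F.pref a (μ' a) (μ a)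

/-- `μ` is a Pareto-efficient matching of the configuration `(F, μ₀)`: it is reachable, and no
reachable matching Pareto-dominates it. -/
def IsParetoEfficient (F : OAF A B) (μ₀ μ : A ≃ B) : Prop :=
  μ ∈ F.reach μ₀ ∧ ∀ μ' ∈ F.reach μ₀, ¬ F.Dominates μ' μ

/-- `μ` is the outcome of serial dictatorship over the reachable matchings, the agents choosing in
the order `σ 0, σ 1, …`: each agent gets its best object among the reachable matchings that
respect the choices of the agents before it. -/
def IsSerialDictatorship (F : OAF A B) (μ₀ : A ≃ B) {n : ℕ} (σ : Fin n ≃ A) (μ : A ≃ B) : Prop :=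
  μ ∈ F.reach μ₀ ∧ ∀ k : Fin n, ∀ ν ∈ F.reach μ₀, (∀ j < k, ν (σ j) = μ (σ j)) →
    ν (σ k) = μ (σ k) ∨ F.pref (σ k) (μ (σ k)) (ν (σ k))

/-- The number of objects that agent `a` prefers to `b`, i.e. the position (from `0`) of `b` in
the preference list of `a`. -/
noncomputable def rank (F : OAF A B) (a : A) (b : B) : ℕ :=
  {b' | F.pref a b' b}.ncard

end OAF

/-! ### A word RAM with a step count -/

/-- The store of a random access machine: registers and arrays, indexed by the natural numbers (a
program names only finitely many of them; all cells are initially `0` apart from the input). -/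
structure Store where
  reg : ℕ → ℕ
  arr : ℕ → ℕ → ℕ

/-- Arithmetic expressions; `get k e` is the content of cell `e` of array `k`. -/
inductive Expr where
  | lit (c : ℕ)
  | reg (x : ℕ)
  | get (k : ℕ) (e : Expr)
  | add (e₁ e₂ : Expr)
  | sub (e₁ e₂ : Expr)
  | mul (e₁ e₂ : Expr)

namespace Expr

/-- The value of an expression (subtraction is truncated at `0`). -/
def eval (s : Store) : Expr → ℕ
  | lit c => c
  | reg x => s.reg x
  | get k e => s.arr k (e.eval s)
  | add e₁ e₂ => e₁.eval s + e₂.eval s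
  | sub e₁ e₂ => e₁.eval s - e₂.eval s
  | mul e₁ e₂ => e₁.eval s * e₂.eval s

/-- The number of unit-cost operations in an expression. -/
def cost : Expr → ℕ
  | lit _ => 1
  | reg _ => 1
  | get _ e => e.cost + 1
  | add e₁ e₂ => e₁.cost + e₂.cost + 1
  | sub e₁ e₂ => e₁.cost + e₂.cost + 1
  | mul e₁ e₂ => e₁.cost + e₂.cost + 1

/-- No overflow: the value of the expression and of each of its parts (array indices included) is
less than `W`, so that it fits into a machine word. -/
def Fits (W : ℕ) (s : Store) : Expr → Prop
  | lit c => c < W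
  | reg x => s.reg x < W
  | get k e => e.Fits W s ∧ s.arr k (e.eval s) < W
  | add e₁ e₂ => e₁.Fits W s ∧ e₂.Fits W s ∧ e₁.eval s + e₂.eval s < W
  | sub e₁ e₂ => e₁.Fits W s ∧ e₂.Fits W s
  | mul e₁ e₂ => e₁.Fits W s ∧ e₂.Fits W s ∧ e₁.eval s * e₂.eval s < W

end Expr

/-- Programs. `assign x e` sets register `x` to `e`; `store k i e` sets cell `i` of array `k` to
`e`; `branch e₁ e₂ p q` runs `p` if `e₁ < e₂` and `q` otherwise; `loop e₁ e₂ p` runs `p` as long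
as `e₁ < e₂`. -/
inductive Program where
  | skip
  | assign (x : ℕ) (e : Expr)
  | store (k : ℕ) (i e : Expr)
  | seq (p q : Program)
  | branch (e₁ e₂ : Expr) (p q : Program)
  | loop (e₁ e₂ : Expr) (p : Program)

namespace Store

/-- Overwrite register `x`. -/
def setReg (s : Store) (x v : ℕ) : Store :=
  { s with reg := Function.update s.reg x v }

/-- Overwrite cell `i` of array `k`. -/
def setArr (s : Store) (k i v : ℕ) : Store :=
  { s with arr := Function.update s.arr k (Function.update (s.arr k) i v) }

end Store

/-- `Exec W p s t s'`: on a machine whose words hold the numbers less than `W`, the program `p`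
started in the store `s` halts in the store `s'` after exactly `t` unit-cost steps, without any
overflow. -/
inductive Exec (W : ℕ) : Program → Store → ℕ → Store → Prop where
  | skip (s : Store) : Exec W .skip s 1 s
  | assign (s : Store) (x : ℕ) (e : Expr) (he : e.Fits W s) :
      Exec W (.assign x e) s (e.cost + 1) (s.setReg x (e.eval s))
  | store (s : Store) (k : ℕ) (i e : Expr) (hi : i.Fits W s) (he : e.Fits W s) :
      Exec W (.store k i e) s (i.cost + e.cost + 1) (s.setArr k (i.eval s) (e.eval s))
  | seq (p q : Program) (s s' s'' : Store) (t t' : ℕ)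
      (hp : Exec W p s t s') (hq : Exec W q s' t' s'') :
      Exec W (.seq p q) s (t + t') s''
  | branch_true (e₁ e₂ : Expr) (p q : Program) (s s' : Store) (t : ℕ)
      (h₁ : e₁.Fits W s) (h₂ : e₂.Fits W s) (h : e₁.eval s < e₂.eval s) (hp : Exec W p s t s') :
      Exec W (.branch e₁ e₂ p q) s (e₁.cost + e₂.cost + 1 + t) s'
  | branch_false (e₁ e₂ : Expr) (p q : Program) (s s' : Store) (t : ℕ)
      (h₁ : e₁.Fits W s) (h₂ : e₂.Fits W s) (h : ¬ e₁.eval s < e₂.eval s)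
      (hq : Exec W q s t s') :
      Exec W (.branch e₁ e₂ p q) s (e₁.cost + e₂.cost + 1 + t) s'
  | loop_done (e₁ e₂ : Expr) (p : Program) (s : Store)
      (h₁ : e₁.Fits W s) (h₂ : e₂.Fits W s) (h : ¬ e₁.eval s < e₂.eval s) :
      Exec W (.loop e₁ e₂ p) s (e₁.cost + e₂.cost + 1) s
  | loop_step (e₁ e₂ : Expr) (p : Program) (s s' s'' : Store) (t t' : ℕ)
      (h₁ : e₁.Fits W s) (h₂ : e₂.Fits W s) (h : e₁.eval s < e₂.eval s)
      (hp : Exec W p s t s') (hl : Exec W (.loop e₁ e₂ p) s' t' s'') :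
      Exec W (.loop e₁ e₂ p) s (e₁.cost + e₂.cost + 1 + t + t') s''

/-! ### Input and output -/

/-- The store `s` holds exactly the configuration `(F, μ₀)` with agents and objects `0, …, n-1`:
register `0` holds `n`; cells `a * n, …, a * n + n - 1` of array `0` hold the preference list of
agent `a`, best object first; array `1` is the adjacency matrix of the graph, row by row; array `2`
is the initial matching; everything else is `0`. -/
structure IsInput {n : ℕ} (F : OAF (Fin n) (Fin n)) (μ₀ : Fin n ≃ Fin n) (s : Store) : Prop where
  size : s.reg 0 = n
  prefs : ∀ a b : Fin n, s.arr 0 (a * n + F.rank a b) = b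
  edges : ∀ b b' : Fin n, F.graph.Adj b b' → s.arr 1 (b * n + b') = 1
  nonedges : ∀ b b' : Fin n, ¬ F.graph.Adj b b' → s.arr 1 (b * n + b') = 0
  initial : ∀ a : Fin n, s.arr 2 a = μ₀ a
  reg_zero : ∀ x, x ≠ 0 → s.reg x = 0
  prefs_zero : ∀ i, n * n ≤ i → s.arr 0 i = 0
  matrix_zero : ∀ i, n * n ≤ i → s.arr 1 i = 0
  initial_zero : ∀ i, n ≤ i → s.arr 2 i = 0
  arr_zero : ∀ k i, 3 ≤ k → s.arr k i = 0

/-- Array `3` of the store `s` holds the matching `μ`. -/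
def IsOutput {n : ℕ} (s : Store) (μ : Fin n ≃ Fin n) : Prop :=
  ∀ a : Fin n, s.arr 3 a = μ a

/-!
Number the positions along the path `0, …, n - 1`, and call `k` the agent that starts at position
`k`. An agent that swaps always improves, so it never turns around: it walks monotonically within a
range `[L k, R k]` that its preferences determine (`IsWalkRange`). Hence in a reachable matching,
seen as a permutation `π`, all agents are in their ranges, and no agent is both overtaken from the
left and from the right, i.e. `π` has no decreasing subsequence of length three
(`IsWalkRange.of_reach`). Conversely every such `π` is reachable, by undoing a crossing of two
agents that end up side by side (`IsWalkRange.reach_of_avoids`).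

A permutation without decreasing subsequence of length three is built by letting the agents
`0, 1, …` choose in turn: each agent either moves beyond all positions chosen so far, or takes the
first hole left behind by its predecessors (`LineStep`). So the state of the process is the queue
of holes and the bound beyond which everything is free. Whether a state can be completed is decided
greedily: having fewer holes, or holes further to the right, never hurts (`Completable.mono`), so
an agent takes the first hole if it can, and otherwise moves right as little as possible
(`completable_cons_iff_pop`, `completable_cons_iff_push`). By the same domination the feasible
targets on the right form an initial segment (`completable_push_of_le`), and the preference
increases along it, so the best choice is the last feasible target, or the first hole.

The running time needs one more idea. One greedy test takes `O(n)` steps, and the targets are tested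
in increasing order, starting with the first one that is better than taking the hole
(`threshold`). Then the first success commits the agent to move right, every success advances the
bound for good, and every failure completes the choice of an agent, which makes at most `2 n` tests
(`SearchInv`, `dictate_spec`). Ranks, the order of the path and the walk ranges are computed in
`O(n ^ 2)` steps beforehand.

Serial dictatorship over a set of matchings is always Pareto-efficient in that set
(`OAF.IsSerialDictatorship.isParetoEfficient`).

Programs are verified with weakest preconditions (`Tri`) that record the exact running time. A loop
rule with a measure bounds the number of rounds, and a syntactic frame lemma (`Exec.frame`) keeps
track of what a program does not touch.
-/

open Relation

/-! ### Reachable matchings as permutations of a line -/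

/-- Exchange of two agents standing on neighbouring positions `π i` and `π i + 1` of a line, both of
which improve; `r k x` is the rank (smaller is better) of position `x` for agent `k`. -/
def LineSwap {n : ℕ} (r : ℕ → ℕ → ℕ) (π π' : Equiv.Perm (Fin n)) : Prop :=
  ∃ i j : Fin n, (π i : ℕ) + 1 = π j ∧ r i (π j) < r i (π i) ∧ r j (π i) < r j (π j) ∧
    π' = Equiv.swap (π i) (π j) * π

/-- `L k` and `R k` are the leftmost and the rightmost position that agent `k`, starting from
position `k`, can walk to while improving with every step. -/
structure IsWalkRange (n : ℕ) (r : ℕ → ℕ → ℕ) (L R : ℕ → ℕ) : Prop where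
  left_le : ∀ k < n, L k ≤ k
  left_step : ∀ k < n, ∀ y, L k ≤ y → y < k → r k y < r k (y + 1)
  left_end : ∀ k < n, ∀ y, y + 1 = L k → ¬ r k y < r k (y + 1)
  le_right : ∀ k < n, k ≤ R k
  right_lt : ∀ k < n, R k < n
  right_step : ∀ k < n, ∀ y, k ≤ y → y < R k → r k (y + 1) < r k y
  right_end : ∀ k < n, R k + 1 < n → ¬ r k (R k + 1) < r k (R k)

section Reach

variable {n : ℕ} {r : ℕ → ℕ → ℕ} {L R : ℕ → ℕ}

/-- Nobody turns around, since that would undo an improvement; so every agent stays in its walk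
range, and of two agents that have passed each other the one from the left has moved right and
the one from the right has moved left. -/
theorem IsWalkRange.of_reach (h : IsWalkRange n r L R) {π : Equiv.Perm (Fin n)}
    (hπ : ReflTransGen (LineSwap r) 1 π) :
    (∀ k : Fin n, L k ≤ π k ∧ (π k : ℕ) ≤ R k) ∧
      ∀ i j, i < j → π j < π i → i < π i ∧ π j < j := by
  induction hπ with
  | refl =>
    refine ⟨fun k => ⟨h.left_le k k.2, h.le_right k k.2⟩, fun i j hij hji => ?_⟩
    exact absurd hij (by simpa using hji.le)
  | @tail π π' _ hs ih =>
    obtain ⟨hb, hinv⟩ := ih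
    obtain ⟨a, b, hab, ha, hb', rfl⟩ := hs
    have hne : a ≠ b := by rintro rfl; omega
    -- an agent that has moved left does not want to move right, and vice versa
    have haR : (a : ℕ) ≤ π a := by
      by_contra hlt
      push Not at hlt
      have := h.left_step a a.2 (π a) (hb a).1 hlt
      rw [hab] at this; omega
    have hbL : (π b : ℕ) ≤ b := by
      by_contra hlt
      push Not at hlt
      have := h.right_step b b.2 (π a) (by omega) (by have := (hb b).2; omega)
      rw [hab] at this; omega
    have hlt : a < b := by
      rcases lt_or_gt_of_ne hne with h1 | h1
      · exact h1
      · have := (hinv b a h1 (Fin.lt_def.2 (by omega))).1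
        rw [Fin.lt_def] at this; omega
    have ea : (Equiv.swap (π a) (π b) * π) a = π b := by simp
    have eb : (Equiv.swap (π a) (π b) * π) b = π a := by simp
    have ex : ∀ x, x ≠ a → x ≠ b → (Equiv.swap (π a) (π b) * π) x = π x := by
      intro x hxa hxb
      simp only [Equiv.Perm.coe_mul, Function.comp_apply]
      exact Equiv.swap_apply_of_ne_of_ne (by simpa using hxa) (by simpa using hxb)
    have hRa : (π a : ℕ) + 1 ≤ R a := by
      by_contra hlt'
      have e : (π a : ℕ) = R a := by have := (hb a).2; omega
      refine h.right_end a a.2 (by rw [← e, hab]; exact (π b).2) ?_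
      rw [← e, hab]; exact ha
    have hLb : L b ≤ π a := by
      by_contra hlt'
      have e : (π a : ℕ) + 1 = L b := by have := (hb b).1; omega
      refine h.left_end b b.2 _ e ?_
      rw [hab]; exact hb'
    have hval : ∀ x y : Fin n, x ≠ y → (π x : ℕ) ≠ π y := fun x y hxy he =>
      hxy (π.injective (Fin.ext he))
    constructor
    · intro k
      by_cases hka : k = a
      · subst hka; rw [ea]; have := h.left_le k k.2; omega
      by_cases hkb : k = b
      · subst hkb; rw [eb]; have := h.le_right k k.2; omega
      rw [ex k hka hkb]; exact hb k
    · intro i j hij hji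
      simp only [Fin.lt_def] at *
      have key : ∀ x y : Fin n, (x : ℕ) < y → (π y : ℕ) < π x → (x : ℕ) < π x ∧ (π y : ℕ) < y :=
        fun x y hxy h1 => hinv x y hxy h1
      by_cases hia : i = a
      · subst hia
        by_cases hjb : j = b
        · subst hjb; rw [ea, eb]; omega
        · have hji' : j ≠ i := by rintro rfl; omega
          rw [ea, ex j hji' hjb] at *
          have := hval j i hji'
          have := key i j hij (by omega); omega
      by_cases hib : i = b
      · subst hib
        have hja : j ≠ a := by rintro rfl; omega
        have hji' : j ≠ i := by rintro rfl; omega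
        rw [eb, ex j hja hji'] at *
        have := key i j hij (by omega); omega
      by_cases hja : j = a
      · subst hja
        rw [ea, ex i hia hib] at *
        have := key i j hij (by omega); omega
      by_cases hjb : j = b
      · subst hjb
        rw [eb, ex i hia hib] at *
        have := hval i j hib
        have := key i j hij (by omega); omega
      rw [ex i hia hib, ex j hja hjb] at *
      exact key i j hij hji

/-- Conversely, a permutation without decreasing subsequence of length three that respects the walk
ranges is reachable: undo the crossing of two agents that end up next to each other, and recurse. -/
theorem IsWalkRange.reach_of_avoids (h : IsWalkRange n r L R) (π : Equiv.Perm (Fin n))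
    (hb : ∀ k : Fin n, L k ≤ π k ∧ (π k : ℕ) ≤ R k)
    (hav : ∀ i j k, i < j → j < k → π j < π i → ¬ π k < π j) :
    ReflTransGen (LineSwap r) 1 π := by
  induction hN : ∑ k : Fin n, ((π k : ℕ) - k) using Nat.strong_induction_on generalizing π with
  | _ N IH =>
  by_cases hid : ∀ p q : Fin n, (p : ℕ) + 1 = q → π.symm p < π.symm q
  · have hmono : StrictMono π.symm := by
      cases n with
      | zero => exact fun i => i.elim0
      | succ n => exact Fin.strictMono_iff_lt_succ.2 fun i => hid _ _ (by simp)
    have : (π.symm : Fin n → Fin n) = id := by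
      refine (StrictMono.range_inj hmono strictMono_id).1 (by simp)
    have : π = 1 := by
      ext k; have := congrFun this (π k); simp at this; rw [← this]; rfl
    rw [this]
  · push Not at hid
    obtain ⟨p, q, hpq, hle⟩ := hid
    obtain ⟨a, rfl⟩ := π.surjective q
    obtain ⟨b, rfl⟩ := π.surjective p
    simp only [Equiv.symm_apply_apply] at hle
    have hne : a ≠ b := by rintro rfl; omega
    have hlt : a < b := lt_of_le_of_ne hle hne
    have hba : π b < π a := Fin.lt_def.2 (by omega)
    -- `a` and everybody before it, as well as `b`, end in the first `π a + 1` positions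
    have ha : (a : ℕ) < π a := by
      have hc : (insert b (Finset.Iio a)).card ≤ (Finset.Iio (π a)).card := by
        refine Finset.card_le_card_of_injOn π ?_ π.injective.injOn
        intro i hi
        simp only [Finset.coe_insert, Finset.coe_Iio, Set.mem_insert_iff, Set.mem_Iio] at hi ⊢
        rcases hi with rfl | hi
        · exact hba
        · by_contra hcon
          exact hav i a b hi hlt (lt_of_le_of_ne (not_lt.1 hcon)
            fun e => hi.ne' (π.injective e)) hba
      rw [Finset.card_insert_of_notMem (by simpa using hle)] at hc
      simpa using hc
    have hb' : (π b : ℕ) < b := by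
      have hc : (insert a (Finset.Ioi b)).card ≤ (Finset.Ioi (π b)).card := by
        refine Finset.card_le_card_of_injOn π ?_ π.injective.injOn
        intro i hi
        simp only [Finset.coe_insert, Finset.coe_Ioi, Set.mem_insert_iff, Set.mem_Ioi] at hi ⊢
        rcases hi with rfl | hi
        · exact hba
        · by_contra hcon
          exact hav a b i hlt hi hba (lt_of_le_of_ne (not_lt.1 hcon)
            fun e => hi.ne' (π.injective e))
      rw [Finset.card_insert_of_notMem (by simpa using hle)] at hc
      simp only [Fin.card_Ioi] at hc
      omega
    set π' := Equiv.swap (π b) (π a) * π with hπ'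
    have ea : π' a = π b := by simp [hπ']
    have eb : π' b = π a := by simp [hπ']
    have ex : ∀ x, x ≠ a → x ≠ b → π' x = π x := by
      intro x hxa hxb
      simp only [hπ', Equiv.Perm.coe_mul, Function.comp_apply]
      exact Equiv.swap_apply_of_ne_of_ne (by simpa using hxb) (by simpa using hxa)
    have hval : ∀ x y : Fin n, x ≠ y → (π x : ℕ) ≠ π y := fun x y hxy he =>
      hxy (π.injective (Fin.ext he))
    -- every crossing of `π'` is one of `π`
    have hinv : ∀ i j, i < j → π' j < π' i → π j < π i := by
      intro i j hij hji
      simp only [Fin.lt_def] at *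
      by_cases hia : i = a
      · subst hia
        by_cases hjb : j = b
        · subst hjb; omega
        · have hji' : j ≠ i := by rintro rfl; omega
          rw [ea, ex j hji' hjb] at *; omega
      by_cases hib : i = b
      · subst hib
        have hja : j ≠ a := by rintro rfl; omega
        have hji' : j ≠ i := by rintro rfl; omega
        rw [eb, ex j hja hji'] at *
        have := hval j i hji'; omega
      by_cases hja : j = a
      · subst hja
        rw [ea, ex i hia hib] at *
        have := hval i j hia; omega
      by_cases hjb : j = b
      · subst hjb
        rw [eb, ex i hia hib] at *; omega
      rwa [ex i hia hib, ex j hja hjb] at *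
    refine ReflTransGen.tail (IH _ ?_ π' ?_ ?_ rfl) ⟨a, b, ?_⟩
    · rw [← hN]
      refine Finset.sum_lt_sum (fun k _ => ?_) ⟨a, Finset.mem_univ _, ?_⟩
      · by_cases hka : k = a
        · subst hka; rw [ea]; omega
        by_cases hkb : k = b
        · subst hkb; rw [eb]; omega
        rw [ex k hka hkb]
      · rw [ea]; omega
    · intro k
      by_cases hka : k = a
      · subst hka; rw [ea]; have := hb k; have := h.left_le k k.2; omega
      by_cases hkb : k = b
      · subst hkb; rw [eb]; have := hb k; have := h.le_right k k.2; omega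
      rw [ex k hka hkb]; exact hb k
    · intro i j k hij hjk h1 h2
      exact hav i j k hij hjk (hinv i j hij h1) (hinv j k hjk h2)
    · rw [ea, eb]
      refine ⟨hpq, ?_, ?_, ?_⟩
      · rw [← hpq]; exact h.right_step a a.2 _ (by omega) (by have := (hb a).2; omega)
      · rw [← hpq]; exact h.left_step b b.2 _ (hb b).1 (by omega)
      · rw [hπ', ← mul_assoc, Equiv.swap_mul_self, one_mul]

end Reach

/-! ### Assigning the positions one agent after the other -/

/-- The state of the assignment of positions to the agents `0, 1, …` in turn: the unassigned
positions below a bound (all positions from the bound on are unassigned), in increasing order, and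
the bound. -/
abbrev LineState := List ℕ × ℕ

/-- Agent `k` either moves left (or stays) and takes the first hole, or moves right (or stays) to a
position `v` beyond all the assigned ones, leaving new holes before `v`. -/
inductive LineStep (L R : ℕ → ℕ) (k : ℕ) : ℕ → LineState → LineState → Prop
  | pop {h : ℕ} {Q : List ℕ} {m : ℕ} (hL : L k ≤ h) : LineStep L R k h (h :: Q, m) (Q, m)
  | push {Q : List ℕ} {m v : ℕ} (hm : m ≤ v) (hR : v ≤ R k) :
      LineStep L R k v (Q, m) (Q ++ List.range' m (v - m), v + 1)

/-- The state `S`, in which agent `k` is to choose, can be continued until all `n` agents have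
chosen. After the last agent every state is accepted: in the states that occur there, no hole is
left, since the bound is at most `n`. -/
inductive Completable (n : ℕ) (L R : ℕ → ℕ) : ℕ → LineState → Prop
  | done (S : LineState) : Completable n L R n S
  | step {k v : ℕ} {S S' : LineState} (hk : k < n) (hs : LineStep L R k v S S')
      (hc : Completable n L R (k + 1) S') : Completable n L R k S

/-- `Chain L R f k S`: the agents before `k` can choose the positions `f 0, …, f (k - 1)` in turn,
which leads to the state `S`. -/
inductive LineChain (L R f : ℕ → ℕ) : ℕ → LineState → Prop
  | zero : LineChain L R f 0 ([], 0)
  | succ {k : ℕ} {S S' : LineState} (hc : LineChain L R f k S) (hs : LineStep L R k (f k) S S') :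
      LineChain L R f (k + 1) S'

/-- The shape of the states that occur when agent `k` is to choose. -/
structure LineState.WF (S : LineState) (k : ℕ) : Prop where
  sorted : S.1.Pairwise (· < ·)
  lt : ∀ h ∈ S.1, h < S.2
  card : S.1.length + k = S.2

section Steps

variable {n : ℕ} {L R f : ℕ → ℕ} {k v : ℕ} {S S' : LineState}

theorem LineStep.wf (hs : LineStep L R k v S S') (hS : S.WF k) : S'.WF (k + 1) := by
  cases hs with
  | pop hL =>
    obtain ⟨h1, h2, h3⟩ := hS
    simp only [List.pairwise_cons, List.mem_cons, forall_eq_or_imp, List.length_cons] at h1 h2 h3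
    exact ⟨h1.2, h2.2, by simp; omega⟩
  | push hm hR =>
    obtain ⟨h1, h2, h3⟩ := hS
    refine ⟨?_, ?_, ?_⟩
    · simp only [List.pairwise_append]
      refine ⟨h1, List.pairwise_lt_range', fun a ha b hb => ?_⟩
      have := h2 a ha
      simp only [List.mem_range'_1] at hb this
      omega
    · intro h hh
      simp only [List.mem_append, List.mem_range'_1] at hh
      rcases hh with hh | hh
      · have := h2 h hh; simp only at this ⊢; omega
      · simp only; omega
    · simp only [List.length_append, List.length_range'] at h3 ⊢; omega

theorem LineChain.wf (hc : LineChain L R f k S) : S.WF k := by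
  induction hc with
  | zero => exact ⟨by simp, by simp, by simp⟩
  | succ _ hs ih => exact hs.wf ih

/-- In a well-formed state the chosen position determines the kind of the step. -/
theorem LineStep.unique {S'' : LineState} (hS : S.WF k) (h₁ : LineStep L R k v S S')
    (h₂ : LineStep L R k v S S'') : S' = S'' := by
  have := hS.lt
  cases h₁ with
  | pop hL =>
    have := this v (by simp)
    cases h₂ with
    | pop => rfl
    | push hm => simp only at this; omega
  | push hm =>
    cases h₂ with
    | pop => have := this v (by simp); simp only at this; omega
    | push => rfl

theorem LineChain.congr {g : ℕ → ℕ} (hc : LineChain L R f k S) (hg : ∀ j < k, g j = f j) :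
    LineChain L R g k S := by
  induction hc with
  | zero => exact .zero
  | @succ k S S' _ hs ih =>
    exact .succ (ih fun j hj => hg j (by omega)) (by rwa [hg k (by omega)])

theorem LineChain.unique (h₁ : LineChain L R f k S) (h₂ : LineChain L R f k S') : S = S' := by
  induction h₁ generalizing S' with
  | zero => cases h₂; rfl
  | succ hc hs ih =>
    cases h₂ with
    | succ hc' hs' => obtain rfl := ih hc'; exact hs.unique hc.wf hs'

/-- The states along a complete chain are completable. -/
theorem LineChain.completable_of_le (hc : LineChain L R f n S) {k : ℕ} (hk : k ≤ n) :
    ∃ S, LineChain L R f k S ∧ Completable n L R k S := by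
  induction hj : n - k generalizing k with
  | zero => obtain rfl : k = n := by omega
            exact ⟨S, hc, .done S⟩
  | succ j ih =>
    obtain ⟨S', h1, h2⟩ := ih (k := k + 1) (by omega) (by omega)
    cases h1 with
    | succ h3 h4 => exact ⟨_, h3, .step (by omega) h4 h2⟩

/-- An assigned position is below the bound and is no longer a hole, and conversely. -/
theorem LineChain.mem_iff (hc : LineChain L R f k S) (v : ℕ) :
    (v < S.2 ∧ v ∉ S.1) ↔ ∃ j < k, f j = v := by
  induction hc with
  | zero => simp
  | @succ k S S' hc hs ih =>
    have hwf := hc.wf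
    have e : (∃ j < k + 1, f j = v) ↔ (∃ j < k, f j = v) ∨ f k = v := by
      constructor
      · rintro ⟨j, hj, h⟩
        rcases Nat.lt_succ_iff_lt_or_eq.1 hj with h1 | rfl
        · exact .inl ⟨j, h1, h⟩
        · exact .inr h
      · rintro (⟨j, hj, h⟩ | h)
        · exact ⟨j, by omega, h⟩
        · exact ⟨k, by omega, h⟩
    rw [e, ← ih]
    generalize f k = w at hs
    have hlt := hwf.lt
    have hsort := hwf.sorted
    cases hs with
    | @pop _ Q m hL =>
      simp only [List.pairwise_cons, List.mem_cons, forall_eq_or_imp] at hsort hlt ⊢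
      constructor
      · rintro ⟨h1, h2⟩
        by_cases h : w = v
        · exact .inr h
        · exact .inl ⟨h1, by rintro (h3 | h3) <;> tauto⟩
      · rintro (⟨h1, h2⟩ | rfl)
        · exact ⟨h1, fun h => h2 (.inr h)⟩
        · exact ⟨hlt.1, fun h => lt_irrefl _ (hsort.1 _ h)⟩
    | @push Q m _ hm hR =>
      simp only [List.mem_append, List.mem_range'_1] at hlt ⊢
      constructor
      · rintro ⟨h1, h2⟩
        by_cases h : w = v
        · exact .inr h
        · push Not at h2
          have := h2.2
          exact .inl ⟨by by_contra h3; have := h2.2 (by omega); omega, h2.1⟩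
      · rintro (⟨h1, h2⟩ | rfl)
        · exact ⟨by omega, by rintro (h3 | h3); exacts [h2 h3, by omega]⟩
        · refine ⟨by omega, ?_⟩
          rintro (h3 | h3)
          · have := hlt _ h3; omega
          · omega

theorem LineChain.injOn (hc : LineChain L R f k S) : ∀ i < k, ∀ j < k, f i = f j → i = j := by
  suffices H : ∀ i j, i < j → j < k → f i ≠ f j by
    intro i hi j hj h
    rcases lt_trichotomy i j with h1 | h1 | h1
    · exact absurd h (H i j h1 hj)
    · exact h1
    · exact absurd h.symm (H j i h1 hi)
  induction hc with
  | zero => intro i j _ h; omega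
  | @succ k S S' hc hs ih =>
    intro i j hij hj h
    rcases Nat.lt_succ_iff_lt_or_eq.1 hj with h1 | rfl
    · exact ih i j hij h1 h
    · have h1 := (hc.mem_iff (f j)).2 ⟨i, hij, h⟩
      generalize f j = w at *
      cases hs with
      | pop => simp at h1
      | push hm => simp only at h1; omega

/-- Every choice lies in the walk range. -/
theorem LineChain.bounds (hc : LineChain L R f k S) (hL : ∀ i < k, L i ≤ i)
    (hR : ∀ i < k, i ≤ R i) : ∀ i < k, L i ≤ f i ∧ f i ≤ R i := by
  induction hc with
  | zero => intro i hi; omega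
  | @succ k S S' hc hs ih =>
    intro i hi
    rcases Nat.lt_succ_iff_lt_or_eq.1 hi with h1 | rfl
    · exact ih (fun j hj => hL j (by omega)) (fun j hj => hR j (by omega)) i h1
    · have hwf := hc.wf
      have h2 := hL i hi
      have h3 := hR i hi
      generalize f i = w at hs ⊢
      have hcard := hwf.card
      have hlt := hwf.lt
      have hsort := hwf.sorted
      cases hs with
      | @pop _ Q m hL =>
        refine ⟨hL, le_trans ?_ h3⟩
        -- the holes are increasing numbers below `m`, and there are `m - i` of them
        have key : ∀ (l : List ℕ) (a : ℕ), (a :: l).Pairwise (· < ·) → (∀ x ∈ a :: l, x < m) →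
            a + (a :: l).length ≤ m := by
          intro l
          induction l with
          | nil => intro a _ h; have := h a (by simp); simp; omega
          | cons b l ih =>
            intro a hp h
            rw [List.pairwise_cons] at hp
            have h4 := ih b hp.2 fun x hx => h x (List.mem_cons_of_mem _ hx)
            have h5 := hp.1 b (by simp)
            simp only [List.length_cons] at h4 ⊢
            omega
        have := key Q w hsort hlt
        simp only at hcard
        omega
      | push hm hR => exact ⟨by simp only at hcard; omega, hR⟩

/-- A chain has no decreasing subsequence of length three: an agent that does not move beyond its
predecessors takes the first hole. -/
theorem LineChain.avoids (hc : LineChain L R f k S) {i j l : ℕ} (hij : i < j) (hjl : j < l)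
    (hl : l < k) (h1 : f j < f i) : ¬ f l < f j := by
  intro h2
  obtain ⟨T, hT, -⟩ := hc.completable_of_le (k := j + 1) (by omega)
  have hun : f l ∈ T.1 ∨ T.2 ≤ f l := by
    by_contra hcon
    push Not at hcon
    obtain ⟨q, hq, he⟩ := (hT.mem_iff (f l)).1 ⟨hcon.2, hcon.1⟩
    have := hc.injOn q (by omega) l hl he
    omega
  cases hT with
  | @succ _ T₀ _ hT₀ hs =>
    have hi := ((hT₀.mem_iff (f i)).2 ⟨i, hij, rfl⟩).1
    have hwf := hT₀.wf
    have hsort := hwf.sorted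
    have hlt := hwf.lt
    generalize f j = w at *
    cases hs with
    | pop =>
      simp only [List.pairwise_cons, List.mem_cons, forall_eq_or_imp] at hsort hlt hun
      rcases hun with hun | hun
      · have := hsort.1 _ hun; omega
      · omega
    | push hm => simp only at hi; omega

/-- A family of positions for the agents that respects the walk ranges and in which an agent
crossed from the left is not crossed from the right is a chain. -/
theorem LineChain.of_crossings (hinj : ∀ i < n, ∀ j < n, f i = f j → i = j)
    (hsurj : ∀ v < n, ∃ j < n, f j = v) (hlt : ∀ i < n, f i < n)
    (hb : ∀ i < n, L i ≤ f i ∧ f i ≤ R i)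
    (hx : ∀ i j l, i < j → j < l → l < n → f j < f i → ¬ f l < f j) :
    ∀ k ≤ n, ∃ S, LineChain L R f k S := by
  intro k hk
  suffices H : ∃ S, LineChain L R f k S ∧ ∀ v < S.2, ∃ i < k, v ≤ f i by
    exact ⟨H.choose, H.choose_spec.1⟩
  induction k with
  | zero => exact ⟨_, .zero, by simp⟩
  | succ k ih =>
    obtain ⟨⟨Q, m⟩, hc, hm⟩ := ih (by omega)
    by_cases h : m ≤ f k
    · refine ⟨_, hc.succ (.push h (hb k hk).2), fun v hv => ⟨k, by omega, ?_⟩⟩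
      simp only at hv; omega
    · push Not at h
      have hQ : f k ∈ Q := by
        by_contra hcon
        obtain ⟨j, hj, he⟩ := (hc.mem_iff (f k)).1 ⟨h, hcon⟩
        have := hinj j (by omega) k hk he
        omega
      have hwf := hc.wf
      cases Q with
      | nil => simp at hQ
      | cons a Q =>
        have hs := hwf.sorted
        have hl := hwf.lt
        simp only [List.pairwise_cons, List.mem_cons, forall_eq_or_imp] at hs hl hQ
        -- otherwise the first hole `a` goes to a later agent, which crosses agent `k`
        have ha : f k = a := by
          by_contra hne
          have hQ' : f k ∈ Q := by tauto
          have h1 := hs.1 _ hQ'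
          obtain ⟨l, hln, rfl⟩ := hsurj a (by have := hlt k hk; omega)
          have hkl : k < l := by
            by_contra hcon
            push Not at hcon
            rcases Nat.lt_or_eq_of_le hcon with h2 | h2
            · have := (hc.mem_iff (f l)).2 ⟨l, h2, rfl⟩
              simp at this
            · rw [h2] at hne; exact hne rfl
          obtain ⟨i, hi, hi'⟩ := hm (f k) h
          refine hx i k l hi hkl hln (lt_of_le_of_ne hi' fun e => ?_) h1
          have := hinj i (by omega) k hk e.symm
          omega
        subst ha
        refine ⟨_, hc.succ (.pop (hb k hk).1), fun v hv => ?_⟩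
        obtain ⟨i, hi, hi'⟩ := hm v hv
        exact ⟨i, by omega, hi'⟩

end Steps

/-! ### Completable states and serial dictatorship -/

/-- `HoleDom Q Q'`: the list `Q'` has at most as many holes as `Q`, and its `i`-th hole is at least
the `i`-th hole of `Q`, hence is at least as easy to reach from the right. -/
inductive HoleDom : List ℕ → List ℕ → Prop
  | nil (Q : List ℕ) : HoleDom Q []
  | cons {h h' : ℕ} {Q Q' : List ℕ} (hh : h ≤ h') (hQ : HoleDom Q Q') : HoleDom (h :: Q) (h' :: Q')

theorem HoleDom.append_self (Q X : List ℕ) : HoleDom (Q ++ X) Q := by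
  induction Q with
  | nil => exact .nil _
  | cons h Q ih => exact .cons le_rfl ih

theorem HoleDom.append {Q Q' : List ℕ} (h : HoleDom Q Q') (X : List ℕ) : HoleDom (Q ++ X) Q' := by
  induction h with
  | nil => exact .nil _
  | cons hh _ ih => exact .cons hh ih

theorem HoleDom.cons_of_sorted {h : ℕ} {Q : List ℕ} (hs : (h :: Q).Pairwise (· < ·)) :
    HoleDom (h :: Q) Q := by
  induction Q generalizing h with
  | nil => exact .nil _
  | cons a Q ih =>
    rw [List.pairwise_cons] at hs
    exact .cons (hs.1 a (by simp)).le (ih hs.2)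

section Completable

variable {n : ℕ} {L R : ℕ → ℕ} {k m : ℕ} {Q : List ℕ}

/-- Fewer holes, and holes further to the right, do not destroy completability: the dominating
state imitates every step, moving right only as far as necessary. -/
theorem Completable.mono (hR : ∀ i < n, i ≤ R i) {S : LineState}
    (hc : Completable n L R k S) {Q' : List ℕ} {m' : ℕ} (hd : HoleDom S.1 Q') (hm : m' ≤ S.2)
    (hS : S.1.length + k = S.2) (hcard : Q'.length + k = m') :
    Completable n L R k (Q', m') := by
  induction hc generalizing Q' m' with
  | done => exact .done _
  | @step k v S S' hk hs _ ih =>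
    cases hs with
    | @pop _ Q m hLv =>
      simp only [List.length_cons] at hS
      cases hd with
      | nil =>
        simp only [List.length_nil, zero_add] at hcard
        subst hcard
        exact .step hk (.push le_rfl (hR k hk)) (ih (by simpa using .nil _) (by simp only; omega)
          (by simp only; omega) (by simp))
      | cons hh hQ =>
        exact .step hk (.pop (hLv.trans hh)) (ih hQ hm (by simp only; omega)
          (by simp at hcard; omega))
    | @push Q m _ hmv hvR =>
      refine .step hk (.push (v := m') le_rfl (by simp only at hm; omega)) (ih ?_ ?_ ?_ ?_)
      · simpa using hd.append _
      · simp only at hm ⊢; omega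
      · simp at hS ⊢; omega
      · simp; omega

theorem completable_nil (hR : ∀ i < n, i ≤ R i) (hk : k ≤ n) : Completable n L R k ([], k) := by
  induction hj : n - k generalizing k with
  | zero => obtain rfl : k = n := by omega
            exact .done _
  | succ j ih =>
    refine .step (by omega) (.push le_rfl (hR k (by omega))) ?_
    simpa using ih (k := k + 1) (by omega) (by omega)

/-- Taking the first hole, when possible, is never a mistake as far as completability goes. -/
theorem completable_cons_iff_pop (hR : ∀ i < n, i ≤ R i) {h : ℕ}
    (hk : k < n) (hwf : LineState.WF (h :: Q, m) k) (hh : L k ≤ h) :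
    Completable n L R k (h :: Q, m) ↔ Completable n L R (k + 1) (Q, m) := by
  refine ⟨fun hc => ?_, fun hc => .step hk (.pop hh) hc⟩
  have hcard := hwf.card
  simp only [List.length_cons] at hcard
  cases hc with
  | done => omega
  | step _ hs hc =>
    cases hs with
    | pop => exact hc
    | push hm hv =>
      refine hc.mono hR ?_ (by simp only; omega) (by simp; omega) (by omega)
      exact HoleDom.append (HoleDom.cons_of_sorted hwf.sorted) _

/-- Moving right less far creates fewer holes, and is at least as completable. -/
theorem completable_push_of_le (hR : ∀ i < n, i ≤ R i) {v w : ℕ}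
    (hcard : Q.length + k = m) (hmw : m ≤ w) (hwv : w ≤ v)
    (hc : Completable n L R (k + 1) (Q ++ List.range' m (v - m), v + 1)) :
    Completable n L R (k + 1) (Q ++ List.range' m (w - m), w + 1) := by
  refine hc.mono hR ?_ (by simp only; omega) (by simp; omega) (by simp; omega)
  have e : Q ++ List.range' m (v - m) =
      (Q ++ List.range' m (w - m)) ++ List.range' w (v - w) := by
    have e2 : m + 1 * (w - m) = w := by omega
    have := List.range'_append (s := m) (m := w - m) (n := v - w) (step := 1)
    rw [e2] at this
    rw [List.append_assoc, this]
    congr 2; omega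
  simp only
  rw [e]
  exact .append_self _ _

/-- An agent that cannot reach the first hole moves right, without loss just beyond its
predecessors. -/
theorem completable_cons_iff_push (hR : ∀ i < n, i ≤ R i) {h : ℕ}
    (hk : k < n) (hwf : LineState.WF (h :: Q, m) k) (hh : ¬ L k ≤ h) :
    Completable n L R k (h :: Q, m) ↔ m ≤ R k ∧ Completable n L R (k + 1) (h :: Q, m + 1) := by
  have hcard := hwf.card
  constructor
  · intro hc
    cases hc with
    | done => omega
    | step _ hs hc =>
      cases hs with
      | pop h' => exact absurd h' hh
      | push hm hv =>
        refine ⟨hm.trans hv, ?_⟩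
        simpa using completable_push_of_le hR hcard le_rfl hm hc
  · rintro ⟨h1, h2⟩
    exact .step hk (.push le_rfl h1) (by simpa using h2)

end Completable

section Reach

variable {n : ℕ} {r : ℕ → ℕ → ℕ} {L R f : ℕ → ℕ}

theorem LineChain.exists_reach (h : IsWalkRange n r L R) {S : LineState}
    (hc : LineChain L R f n S) :
    ∃ π : Equiv.Perm (Fin n), (∀ k : Fin n, (π k : ℕ) = f k) ∧
      ReflTransGen (LineSwap r) 1 π := by
  have hb := hc.bounds h.left_le h.le_right
  let g : Fin n → Fin n := fun k => ⟨f k, lt_of_le_of_lt (hb k k.2).2 (h.right_lt k k.2)⟩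
  have hg : Function.Injective g := fun i j hij =>
    Fin.ext (hc.injOn i i.2 j j.2 (congrArg Fin.val hij))
  refine ⟨Equiv.ofBijective g (Finite.injective_iff_bijective.1 hg), fun k => rfl, ?_⟩
  exact h.reach_of_avoids _ (fun k => hb k k.2)
    fun i j k hij hjk h1 h2 => hc.avoids hij hjk k.2 h1 h2

theorem LineChain.of_reach (h : IsWalkRange n r L R) {π : Equiv.Perm (Fin n)}
    (hπ : ReflTransGen (LineSwap r) 1 π) (hf : ∀ k : Fin n, f k = π k) :
    ∃ S, LineChain L R f n S := by
  obtain ⟨hb, hx⟩ := h.of_reach hπ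
  refine LineChain.of_crossings (n := n) ?_ ?_ ?_ ?_ ?_ n le_rfl
  · intro i hi j hj he
    have := π.injective (Fin.ext (((hf ⟨i, hi⟩).symm.trans he).trans (hf ⟨j, hj⟩)))
    simpa using this
  · intro v hv
    refine ⟨π.symm ⟨v, hv⟩, (π.symm ⟨v, hv⟩).2, ?_⟩
    rw [hf, Equiv.apply_symm_apply]
  · intro i hi; rw [hf ⟨i, hi⟩]; exact (π _).2
  · intro i hi; rw [hf ⟨i, hi⟩]; exact hb ⟨i, hi⟩
  · intro i j l hij hjl hl h1 h2
    have e1 := hf ⟨i, by omega⟩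
    have e2 := hf ⟨j, by omega⟩
    have e3 := hf ⟨l, hl⟩
    simp only [Fin.lt_def] at hx
    simp only at e1 e2 e3
    have h3 := (hx ⟨i, by omega⟩ ⟨j, by omega⟩ hij (by omega)).2
    have h4 := (hx ⟨j, by omega⟩ ⟨l, hl⟩ hjl (by omega)).1
    simp only at h3 h4
    omega

end Reach

namespace OAF

variable {A B : Type*} [Fintype A] [Fintype B]

theorem pref_iff_rank_lt (F : OAF A B) (a : A) (b b' : B) :
    F.pref a b b' ↔ F.rank a b < F.rank a b' := by
  have := F.pref_strict a
  have key : ∀ x y, F.pref a x y → F.rank a x < F.rank a y := fun x y h =>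
    Set.ncard_lt_ncard ⟨fun z hz => _root_.trans (r := F.pref a) hz h,
      fun hs => irrefl (r := F.pref a) x (hs h)⟩ (Set.toFinite _)
  refine ⟨key b b', fun h => ?_⟩
  rcases trichotomous_of (F.pref a) b b' with h1 | h1 | h1
  · exact h1
  · rw [h1] at h; omega
  · have := key _ _ h1; omega

theorem rank_injective (F : OAF A B) (a : A) : Function.Injective (F.rank a) := by
  have := F.pref_strict a
  intro b b' h
  rcases trichotomous_of (F.pref a) b b' with h1 | h1 | h1
  · rw [pref_iff_rank_lt] at h1; omega
  · exact h1
  · rw [pref_iff_rank_lt] at h1; omega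

theorem rank_lt (F : OAF A B) (a : A) (b : B) : F.rank a b < Fintype.card B := by
  have := F.pref_strict a
  rw [← Nat.card_eq_fintype_card, ← Set.ncard_univ]
  exact Set.ncard_lt_ncard ⟨Set.subset_univ _, fun hs => irrefl (r := F.pref a) b (hs trivial)⟩
    (Set.toFinite _)

/-- Serial dictatorship is Pareto-efficient: the first dictator whose object changes in a
dominating matching could have chosen the better object. -/
theorem IsSerialDictatorship.isParetoEfficient {F : OAF A B} {μ₀ μ : A ≃ B} {n : ℕ}
    {σ : Fin n ≃ A} (h : F.IsSerialDictatorship μ₀ σ μ) : F.IsParetoEfficient μ₀ μ := by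
  refine ⟨h.1, fun μ' hμ' ⟨hdom, a, ha⟩ => ?_⟩
  suffices H : ∀ m, ∀ k : Fin n, (k : ℕ) = m → μ' (σ k) = μ (σ k) by
    have := H _ (σ.symm a) rfl
    rw [Equiv.apply_symm_apply] at this
    rw [this, pref_iff_rank_lt] at ha
    omega
  intro m
  induction m using Nat.strong_induction_on with
  | _ m ih =>
    intro k hk
    rcases h.2 k μ' hμ' fun j hj => ih j (by rw [Fin.lt_def] at hj; omega) j rfl with h1 | h1
    · exact h1
    · rcases hdom (σ k) with h2 | h2
      · exact h2
      · rw [pref_iff_rank_lt] at h1 h2; omega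

/-- The objects of the agents as a permutation of the positions on the path: the agent that starts
at position `k` stands at position `F.posPerm e μ₀ μ k` in the matching `μ`. -/
def posPerm (F : OAF A B) {n : ℕ} (e : SimpleGraph.pathGraph n ≃g F.graph) (μ₀ μ : A ≃ B) :
    Equiv.Perm (Fin n) :=
  ((e.toEquiv.trans μ₀.symm).trans μ).trans e.toEquiv.symm

theorem mem_reach_iff_posPerm (F : OAF A B) {n : ℕ} (e : SimpleGraph.pathGraph n ≃g F.graph)
    (μ₀ : A ≃ B) {r : ℕ → ℕ → ℕ} (hr : ∀ k x : Fin n, r k x = F.rank (μ₀.symm (e k)) (e x))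
    (μ : A ≃ B) :
    μ ∈ F.reach μ₀ ↔ ReflTransGen (LineSwap r) 1 (F.posPerm e μ₀ μ) := by
  have hpos : ∀ (ν : A ≃ B) (a : A), e (F.posPerm e μ₀ ν (e.symm (μ₀ a))) = ν a := by
    intro ν a
    simp only [posPerm, Equiv.trans_apply]
    change e (e.symm (ν (μ₀.symm (e (e.symm (μ₀ a)))))) = ν a
    simp
  have hpos' : ∀ (ν : A ≃ B) (k : Fin n), F.posPerm e μ₀ ν k = e.symm (ν (μ₀.symm (e k))) :=
    fun _ _ => rfl
  constructor
  · intro h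
    have h1 : F.posPerm e μ₀ μ₀ = 1 := by
      ext k; rw [hpos']; simp
    rw [← h1]
    refine ReflTransGen.lift (F.posPerm e μ₀) ?_ _ _ h
    rintro ν ν' ⟨a, a', hadj, ha, ha', e1, e2, e3⟩
    wlog hlt : (e.symm (ν a) : ℕ) + 1 = e.symm (ν a') generalizing a a'
    · refine this a' a hadj.symm ha' ha e2 e1 (fun x hx hx' => e3 x hx' hx) ?_
      rw [← e.symm.map_rel_iff, SimpleGraph.pathGraph_adj] at hadj
      tauto
    have hak : ∀ b : A, μ₀.symm (e (e.symm (μ₀ b))) = b := by simp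
    refine ⟨e.symm (μ₀ a), e.symm (μ₀ a'), ?_, ?_, ?_, ?_⟩
    · simp only [hpos', hak]; exact hlt
    · rw [hr, hr, hpos, hpos, hak, ← pref_iff_rank_lt]; exact ha
    · rw [hr, hr, hpos, hpos, hak, ← pref_iff_rank_lt]; exact ha'
    · refine Equiv.ext fun k => ?_
      obtain ⟨x, rfl⟩ : ∃ x, e.symm (μ₀ x) = k := ⟨μ₀.symm (e k), by simp⟩
      simp only [Equiv.Perm.coe_mul, Function.comp_apply, hpos', hak]
      by_cases hx : x = a
      · subst hx; rw [Equiv.swap_apply_left, e1]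
      by_cases hx' : x = a'
      · subst hx'; rw [Equiv.swap_apply_right, e2]
      rw [e3 x hx hx', Equiv.swap_apply_of_ne_of_ne] <;> simpa
  · intro h
    let mt : Equiv.Perm (Fin n) → (A ≃ B) := fun π =>
      ((e.toEquiv.trans μ₀.symm).symm.trans π).trans e.toEquiv
    have hmt : ∀ π k, mt π (μ₀.symm (e k)) = e (π k) := by
      intro π k
      change e (π (e.symm (μ₀ (μ₀.symm (e k))))) = _
      simp
    have h1 : mt 1 = μ₀ := by
      ext a
      obtain ⟨k, rfl⟩ : ∃ k, μ₀.symm (e k) = a := ⟨e.symm (μ₀ a), by simp⟩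
      rw [hmt]; simp
    have h2 : mt (F.posPerm e μ₀ μ) = μ := by
      ext a
      obtain ⟨k, rfl⟩ : ∃ k, μ₀.symm (e k) = a := ⟨e.symm (μ₀ a), by simp⟩
      rw [hmt, hpos']; simp
    suffices H : ∀ π π', LineSwap r π π' → F.Swap (mt π) (mt π') by
      have := ReflTransGen.lift (p := F.Swap) mt H _ _ h
      change ReflTransGen F.Swap μ₀ μ
      simpa only [Function.onFun, h1, h2] using this
    rintro π π' ⟨i, j, hij, hi, hj, rfl⟩
    refine ⟨μ₀.symm (e i), μ₀.symm (e j), ?_, ?_, ?_, ?_, ?_, ?_⟩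
    · rw [hmt, hmt, e.map_rel_iff, SimpleGraph.pathGraph_adj]; exact .inl hij
    · rw [pref_iff_rank_lt, hmt, hmt, ← hr, ← hr]; exact hi
    · rw [pref_iff_rank_lt, hmt, hmt, ← hr, ← hr]; exact hj
    · rw [hmt, hmt]; simp
    · rw [hmt, hmt]; simp
    · intro x hx hx'
      obtain ⟨k, rfl⟩ : ∃ k, μ₀.symm (e k) = x := ⟨e.symm (μ₀ x), by simp⟩
      rw [hmt, hmt, Equiv.Perm.coe_mul, Function.comp_apply, Equiv.swap_apply_of_ne_of_ne]
      · rintro h; rw [π.injective h] at hx; exact hx rfl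
      · rintro h; rw [π.injective h] at hx'; exact hx' rfl

end OAF

/-- Every choice in the chain `f` up to `k` is the best one among the choices that can be
continued to a complete chain. -/
def IsBestChain (n : ℕ) (r : ℕ → ℕ → ℕ) (L R f : ℕ → ℕ) (k : ℕ) : Prop :=
  ∀ j < k, ∀ S, LineChain L R f j S → ∀ v S', LineStep L R j v S S' →
    Completable n L R (j + 1) S' → v = f j ∨ r j (f j) < r j v

/-- A complete chain of best choices describes the outcome of serial dictatorship along the path. -/
theorem OAF.exists_isSerialDictatorship {A B : Type*} [Fintype A] [Fintype B] (F : OAF A B) {n : ℕ}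
    (e : SimpleGraph.pathGraph n ≃g F.graph) (μ₀ : A ≃ B) {r : ℕ → ℕ → ℕ}
    (hr : ∀ k x : Fin n, r k x = F.rank (μ₀.symm (e k)) (e x)) {L R f : ℕ → ℕ}
    (h : IsWalkRange n r L R) {S : LineState} (hc : LineChain L R f n S)
    (hbest : IsBestChain n r L R f n) :
    ∃ μ : A ≃ B, (∀ k x : Fin n, f k = x → μ (μ₀.symm (e k)) = e x) ∧
      F.IsSerialDictatorship μ₀ (e.toEquiv.trans μ₀.symm) μ := by
  obtain ⟨π, hπ, hreach⟩ := hc.exists_reach h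
  let μ : A ≃ B := ((e.toEquiv.trans μ₀.symm).symm.trans π).trans e.toEquiv
  have hμ : ∀ k, μ (μ₀.symm (e k)) = e (π k) := by
    intro k
    change e (π (e.symm (μ₀ (μ₀.symm (e k))))) = _
    simp
  have hpos : F.posPerm e μ₀ μ = π := by
    ext k
    change (e.symm (μ (μ₀.symm (e k))) : ℕ) = _
    rw [hμ]; simp
  refine ⟨μ, fun k x hx => ?_, ?_, fun k ν hν hag => ?_⟩
  · rw [hμ]; congr 1; exact Fin.ext ((hπ k).trans hx)
  · rw [F.mem_reach_iff_posPerm e μ₀ hr, hpos]; exact hreach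
  · rw [F.mem_reach_iff_posPerm e μ₀ hr] at hν
    have hσ : ∀ j : Fin n, (e.toEquiv.trans μ₀.symm) j = μ₀.symm (e j) := fun _ => rfl
    have hνpos : ∀ j : Fin n, F.posPerm e μ₀ ν j = e.symm (ν (μ₀.symm (e j))) := fun _ => rfl
    let g : ℕ → ℕ := fun j => if hj : j < n then F.posPerm e μ₀ ν ⟨j, hj⟩ else 0
    have hg : ∀ j : Fin n, g j = F.posPerm e μ₀ ν j := fun j => by simp [g]
    obtain ⟨T, hT⟩ := LineChain.of_reach h hν hg
    obtain ⟨T₁, hT₁, hcomp⟩ := hT.completable_of_le (k := k + 1) k.2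
    cases hT₁ with
    | @succ _ T₀ _ hT₀ hs =>
      have hfg : ∀ j < (k : ℕ), f j = g j := by
        intro j hj
        have hjn : j < n := hj.trans k.2
        have h1 := hag ⟨j, hjn⟩ hj
        rw [hσ] at h1
        have h2 := hg ⟨j, hjn⟩
        rw [hνpos, h1, hμ] at h2
        simp only [RelIso.symm_apply_apply] at h2
        rw [h2]; exact (hπ ⟨j, hjn⟩).symm
      have hx : e (F.posPerm e μ₀ ν k) = ν (μ₀.symm (e k)) := by rw [hνpos]; simp
      rw [hσ, hμ, ← hx, OAF.pref_iff_rank_lt, ← hr, ← hr, ← hg, hπ]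
      rcases hbest k k.2 T₀ (hT₀.congr hfg) _ _ hs hcomp with h1 | h1
      · left; congr 1; exact Fin.ext (by rw [← hg, h1, hπ])
      · exact .inr h1

/-! ### Program logic for the word RAM -/

@[simp] theorem Store.setReg_reg (s : Store) (x v y : ℕ) :
    (s.setReg x v).reg y = if y = x then v else s.reg y := by
  simp [Store.setReg, Function.update_apply]

@[simp] theorem Store.setReg_arr (s : Store) (x v : ℕ) : (s.setReg x v).arr = s.arr := rfl

@[simp] theorem Store.setArr_reg (s : Store) (k i v : ℕ) : (s.setArr k i v).reg = s.reg := rfl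

@[simp] theorem Store.setArr_arr (s : Store) (k i v k' : ℕ) :
    (s.setArr k i v).arr k' = if k' = k then Function.update (s.arr k) i v else s.arr k' := by
  simp [Store.setArr, Function.update_apply]

/-- `Tri W p s Q`: the program `p` started in `s` halts without overflow, and its running time and
final store satisfy `Q`. -/
def Tri (W : ℕ) (p : Program) (s : Store) (Q : ℕ → Store → Prop) : Prop :=
  ∃ t s', Exec W p s t s' ∧ Q t s'

section Tri

variable {W : ℕ} {s : Store} {Q : ℕ → Store → Prop} {p q : Program} {e₁ e₂ : Expr}

theorem Tri.imp {Q' : ℕ → Store → Prop} (h : Tri W p s Q) (hQ : ∀ t s', Q t s' → Q' t s') :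
    Tri W p s Q' := by
  obtain ⟨t, s', h1, h2⟩ := h
  exact ⟨t, s', h1, hQ _ _ h2⟩

theorem tri_skip : Tri W .skip s Q ↔ Q 1 s :=
  ⟨fun ⟨_, _, h1, h2⟩ => by cases h1; exact h2, fun h => ⟨_, _, .skip _, h⟩⟩

theorem tri_assign {x : ℕ} {e : Expr} :
    Tri W (.assign x e) s Q ↔ e.Fits W s ∧ Q (e.cost + 1) (s.setReg x (e.eval s)) :=
  ⟨fun ⟨_, _, h1, h2⟩ => by cases h1; exact ⟨by assumption, h2⟩,
    fun h => ⟨_, _, .assign _ _ _ h.1, h.2⟩⟩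

theorem tri_store {k : ℕ} {i e : Expr} :
    Tri W (.store k i e) s Q ↔
      i.Fits W s ∧ e.Fits W s ∧ Q (i.cost + e.cost + 1) (s.setArr k (i.eval s) (e.eval s)) :=
  ⟨fun ⟨_, _, h1, h2⟩ => by cases h1; exact ⟨by assumption, by assumption, h2⟩,
    fun h => ⟨_, _, .store _ _ _ _ h.1 h.2.1, h.2.2⟩⟩

theorem tri_seq :
    Tri W (.seq p q) s Q ↔ Tri W p s fun t s' => Tri W q s' fun t' s'' => Q (t + t') s'' :=
  ⟨fun ⟨_, _, h1, h2⟩ => by cases h1; exact ⟨_, _, by assumption, _, _, by assumption, h2⟩,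
    fun ⟨_, _, h1, _, _, h2, h3⟩ => ⟨_, _, .seq _ _ _ _ _ _ _ h1 h2, h3⟩⟩

theorem tri_branch :
    Tri W (.branch e₁ e₂ p q) s Q ↔ e₁.Fits W s ∧ e₂.Fits W s ∧
      (e₁.eval s < e₂.eval s → Tri W p s fun t s' => Q (e₁.cost + e₂.cost + 1 + t) s') ∧
      (¬ e₁.eval s < e₂.eval s → Tri W q s fun t s' => Q (e₁.cost + e₂.cost + 1 + t) s') := by
  constructor
  · rintro ⟨t, s', h1, h2⟩
    cases h1 with
    | branch_true _ _ _ _ _ _ t h₁ h₂ h hp => exact ⟨h₁, h₂, fun _ => ⟨_, _, hp, h2⟩, by tauto⟩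
    | branch_false _ _ _ _ _ _ t h₁ h₂ h hp => exact ⟨h₁, h₂, by tauto, fun _ => ⟨_, _, hp, h2⟩⟩
  · rintro ⟨h₁, h₂, h3, h4⟩
    by_cases h : e₁.eval s < e₂.eval s
    · obtain ⟨t, s', h5, h6⟩ := h3 h
      exact ⟨_, _, .branch_true _ _ _ _ _ _ _ h₁ h₂ h h5, h6⟩
    · obtain ⟨t, s', h5, h6⟩ := h4 h
      exact ⟨_, _, .branch_false _ _ _ _ _ _ _ h₁ h₂ h h5, h6⟩

/-- The registers that a program may overwrite. -/
def Program.regs : Program → List ℕ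
  | .skip => []
  | .assign x _ => [x]
  | .store _ _ _ => []
  | .seq p q => p.regs ++ q.regs
  | .branch _ _ p q => p.regs ++ q.regs
  | .loop _ _ p => p.regs

/-- The arrays that a program may overwrite. -/
def Program.arrs : Program → List ℕ
  | .skip => []
  | .assign _ _ => []
  | .store k _ _ => [k]
  | .seq p q => p.arrs ++ q.arrs
  | .branch _ _ p q => p.arrs ++ q.arrs
  | .loop _ _ p => p.arrs

/-- `s` and `s'` agree on everything that the program `p` does not overwrite. -/
def Program.Frame (p : Program) (s s' : Store) : Prop :=
  (∀ x ∉ p.regs, s'.reg x = s.reg x) ∧ ∀ k ∉ p.arrs, s'.arr k = s.arr k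

theorem Program.Frame.reg {s' : Store} (h : p.Frame s s') (x : ℕ) (hx : x ∉ p.regs) :
    s'.reg x = s.reg x := h.1 x hx

theorem Program.Frame.arr {s' : Store} (h : p.Frame s s') (k : ℕ) (hk : k ∉ p.arrs) :
    s'.arr k = s.arr k := h.2 k hk

theorem Program.Frame.trans {s' s'' : Store} (h : p.Frame s s') (h' : p.Frame s' s'') :
    p.Frame s s'' :=
  ⟨fun x hx => (h'.1 x hx).trans (h.1 x hx), fun k hk => (h'.2 k hk).trans (h.2 k hk)⟩

/-- A program changes only the registers and arrays that it names as targets. -/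
theorem Exec.frame {t : ℕ} {s' : Store} (h : Exec W p s t s') : p.Frame s s' := by
  induction h with
  | skip => exact ⟨fun _ _ => rfl, fun _ _ => rfl⟩
  | assign => exact ⟨fun x hx => by simp_all [Program.regs], fun _ _ => rfl⟩
  | store => exact ⟨fun _ _ => rfl, fun k hk => by simp_all [Program.arrs]⟩
  | seq p q _ _ _ _ _ _ _ ih ih' =>
    exact ⟨fun x hx => by simp only [Program.regs, List.mem_append, not_or] at hx
                          rw [ih'.1 x hx.2, ih.1 x hx.1],
      fun k hk => by simp only [Program.arrs, List.mem_append, not_or] at hk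
                     rw [ih'.2 k hk.2, ih.2 k hk.1]⟩
  | branch_true _ _ _ _ _ _ _ _ _ _ _ ih =>
    exact ⟨fun x hx => ih.1 x (by simp_all [Program.regs]),
      fun k hk => ih.2 k (by simp_all [Program.arrs])⟩
  | branch_false _ _ _ _ _ _ _ _ _ _ _ ih =>
    exact ⟨fun x hx => ih.1 x (by simp_all [Program.regs]),
      fun k hk => ih.2 k (by simp_all [Program.arrs])⟩
  | loop_done => exact ⟨fun _ _ => rfl, fun _ _ => rfl⟩
  | loop_step _ _ _ _ _ _ _ _ _ _ _ _ _ ih ih' =>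
    exact ⟨fun x hx => (ih'.1 x hx).trans (ih.1 x hx),
      fun k hk => (ih'.2 k hk).trans (ih.2 k hk)⟩

theorem Tri.frame (h : Tri W p s Q) : Tri W p s fun t s' => Q t s' ∧ p.Frame s s' := by
  obtain ⟨t, s', h1, h2⟩ := h
  exact ⟨t, s', h1, h2, h1.frame⟩

/-- The loop rule: an invariant with a measure that every round of the loop decreases. If a round
takes at most `c` steps and the measure is initially `N`, then the loop takes at most
`(N + 1) * (c + K)` steps, `K` being the cost of the test. -/
theorem tri_loop (I : ℕ → Store → Prop) (c N : ℕ) (hI : I N s)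
    (hstep : ∀ m s', p.Frame s s' → I m s' → e₁.Fits W s' ∧ e₂.Fits W s' ∧
      (e₁.eval s' < e₂.eval s' → Tri W p s' fun t s'' => t ≤ c ∧ ∃ m' < m, I m' s''))
    (hQ : ∀ t s' m, t ≤ (N + 1) * (c + (e₁.cost + e₂.cost + 1)) → p.Frame s s' → I m s' →
      ¬ e₁.eval s' < e₂.eval s' → Q t s') : Tri W (.loop e₁ e₂ p) s Q := by
  suffices H : ∀ N s₀, p.Frame s s₀ → I N s₀ → ∃ t s' m, Exec W (.loop e₁ e₂ p) s₀ t s' ∧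
      t ≤ (N + 1) * (c + (e₁.cost + e₂.cost + 1)) ∧ I m s' ∧ ¬ e₁.eval s' < e₂.eval s' by
    obtain ⟨t, s', m, h1, h2, h3, h4⟩ := H N s ⟨fun _ _ => rfl, fun _ _ => rfl⟩ hI
    exact ⟨t, s', h1, hQ t s' m h2 h1.frame h3 h4⟩
  intro N
  induction N using Nat.strong_induction_on with
  | _ N ih =>
  intro s₀ hs₀ hN
  obtain ⟨h1, h2, h3⟩ := hstep N s₀ hs₀ hN
  by_cases h : e₁.eval s₀ < e₂.eval s₀
  · obtain ⟨t, s₁, hp, ht, m', hm', hI'⟩ := h3 h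
    obtain ⟨t', s', m, h4, h5, h6, h7⟩ := ih m' hm' s₁ (hs₀.trans hp.frame) hI'
    refine ⟨_, s', m, .loop_step _ _ _ _ _ _ _ _ h1 h2 h hp h4, ?_, h6, h7⟩
    have : (m' + 1 + 1) * (c + (e₁.cost + e₂.cost + 1)) ≤
        (N + 1) * (c + (e₁.cost + e₂.cost + 1)) := Nat.mul_le_mul_right _ (by omega)
    have e : (m' + 1 + 1) * (c + (e₁.cost + e₂.cost + 1)) =
      (m' + 1) * (c + (e₁.cost + e₂.cost + 1)) + (c + (e₁.cost + e₂.cost + 1)) := by ring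
    omega
  · refine ⟨_, s₀, N, .loop_done _ _ _ _ h1 h2 h, ?_, hN, h⟩
    have : 1 * (c + (e₁.cost + e₂.cost + 1)) ≤
        (N + 1) * (c + (e₁.cost + e₂.cost + 1)) := Nat.mul_le_mul_right _ (by omega)
    omega

end Tri

theorem index_lt {n a b : ℕ} (ha : a < n) (hb : b < n) : a * n + b < n * n := by
  have : (a + 1) * n ≤ n * n := Nat.mul_le_mul_right _ ha
  rw [Nat.add_mul] at this
  omega

theorem index_inj {n a b a' b' : ℕ} (hb : b < n) (hb' : b' < n) :
    a * n + b = a' * n + b' ↔ a = a' ∧ b = b' := by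
  refine ⟨fun h => ?_, by rintro ⟨rfl, rfl⟩; rfl⟩
  have h1 : (a * n + b) / n = (a' * n + b') / n := by rw [h]
  rw [Nat.mul_comm, Nat.mul_add_div (by omega), Nat.mul_comm, Nat.mul_add_div (by omega),
    Nat.div_eq_of_lt hb, Nat.div_eq_of_lt hb'] at h1
  obtain rfl : a = a' := by omega
  exact ⟨rfl, by omega⟩

/-! ### Tabulating the preferences -/

/-- Tabulate the inverse of the initial matching in array `5`, and the ranks in array `6`: cell
`a * n + b` is the rank of object `b` for agent `a`. -/
def tabulate : Program :=
  .seq (.assign 1 (.lit 0)) <|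
  .loop (.reg 1) (.reg 0) <|
    .seq (.store 5 (.get 2 (.reg 1)) (.reg 1)) <|
    .seq (.assign 2 (.lit 0)) <|
    .seq (.loop (.reg 2) (.reg 0) <|
      .seq (.store 6 (.add (.mul (.reg 1) (.reg 0))
        (.get 0 (.add (.mul (.reg 1) (.reg 0)) (.reg 2)))) (.reg 2)) <|
      .assign 2 (.add (.reg 2) (.lit 1))) <|
    .assign 1 (.add (.reg 1) (.lit 1))

theorem tabulate_spec {W n : ℕ} (hn : 0 < n) (hW : 10 * (n * n) + 10 ≤ W) {s : Store}
    {mu : ℕ → ℕ} {rk : ℕ → ℕ → ℕ} (hs : s.reg 0 = n)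
    (hrk : ∀ a < n, ∀ b < n, s.arr 0 (a * n + rk a b) = b)
    (hsurj : ∀ a < n, ∀ i < n, ∃ b < n, rk a b = i)
    (hmu : ∀ a < n, s.arr 2 a = mu a) (hmult : ∀ a < n, mu a < n)
    (hinj : ∀ a < n, ∀ a' < n, mu a = mu a' → a = a') (hrklt : ∀ a < n, ∀ b < n, rk a b < n) :
    Tri W tabulate s fun t s' => t ≤ 200 * (n * n) ∧
      (∀ a < n, s'.arr 5 (mu a) = a) ∧ ∀ a < n, ∀ b < n, s'.arr 6 (a * n + b) = rk a b := by
  have hnn : n ≤ n * n := Nat.le_mul_self n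
  simp only [tabulate, tri_seq, tri_assign, Expr.Fits, Expr.eval, Expr.cost]
  refine ⟨by omega, ?_⟩
  refine tri_loop (fun m s' => m + s'.reg 1 = n ∧ (∀ a < s'.reg 1, s'.arr 5 (mu a) = a) ∧
    ∀ a < s'.reg 1, ∀ b < n, s'.arr 6 (a * n + b) = rk a b) (80 * n) n ?_ ?_ ?_
  · simp
  · rintro m s₁ hf ⟨h1, h2, h3⟩
    have f0 : s₁.reg 0 = n := by rw [hf.reg 0 (by decide)]; simpa using hs
    have f1 : s₁.arr 0 = s.arr 0 := by rw [hf.arr 0 (by decide)]; simp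
    have f2 : s₁.arr 2 = s.arr 2 := by rw [hf.arr 2 (by decide)]; simp
    simp only [tri_seq, tri_store, tri_assign, Expr.Fits, Expr.eval, Expr.cost, f0, f2]
    refine ⟨by omega, by omega, fun hlt => ?_⟩
    have := hmult _ hlt
    rw [hmu _ hlt]
    refine ⟨by omega, by omega, by omega, ?_⟩
    refine tri_loop (fun m s' => m + s'.reg 2 = n ∧ (∀ b < n, rk (s₁.reg 1) b < s'.reg 2 →
        s'.arr 6 (s₁.reg 1 * n + b) = rk (s₁.reg 1) b) ∧
        ∀ a < s₁.reg 1, ∀ b < n, s'.arr 6 (a * n + b) = rk a b) 20 n ?_ ?_ ?_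
    · simpa using h3
    · rintro m s₂ hf' ⟨h4, h5, h6⟩
      have g0 : s₂.reg 0 = n := by rw [hf'.reg 0 (by decide)]; simpa using f0
      have g1 : s₂.reg 1 = s₁.reg 1 := by rw [hf'.reg 1 (by decide)]; simp
      have g2 : s₂.arr 0 = s.arr 0 := by rw [hf'.arr 0 (by decide)]; simp [f1]
      simp only [tri_seq, tri_store, tri_assign, Expr.Fits, Expr.eval, Expr.cost, g0, g1, g2]
      refine ⟨by omega, by omega, fun hlt' => ?_⟩
      obtain ⟨b, hb, hbi⟩ := hsurj _ hlt _ hlt'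
      have h7 := hrk _ hlt b hb
      rw [hbi] at h7
      rw [h7]
      have := index_lt hlt hlt'
      have := index_lt hlt hb
      simp only [Store.setArr_reg, Store.setReg_reg, Store.setReg_arr, Store.setArr_arr,
        ↓reduceIte, Function.update_apply]
      refine ⟨by omega, by omega, by omega, by omega, m - 1, by omega, by omega, fun b' hb' hlt'' => ?_,
        fun a ha b' hb' => ?_⟩
      · simp only [Nat.add_left_cancel_iff]
        split_ifs with h
        · rw [h, hbi]
        · refine h5 b' hb' (lt_of_le_of_ne (by omega) fun h8 => h ?_)
          have h9 := hrk _ hlt b' hb'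
          rw [h8] at h9
          omega
      · rw [if_neg, h6 a ha b' hb']
        rw [index_inj hb' hb]
        omega
    · rintro t s₂ m ht hf' ⟨h4, h5, h6⟩ hc
      have g0 : s₂.reg 0 = n := by rw [hf'.reg 0 (by decide)]; simpa using f0
      have g1 : s₂.reg 1 = s₁.reg 1 := by rw [hf'.reg 1 (by decide)]; simp
      have g2 : s₂.arr 5 = Function.update (s₁.arr 5) (mu (s₁.reg 1)) (s₁.reg 1) := by
        rw [hf'.arr 5 (by decide)]; simp
      simp only [Expr.eval, Expr.cost, g0] at hc ht
      simp only [Store.setReg_reg, Store.setReg_arr, ↓reduceIte, g1, g2, Function.update_apply]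
      refine ⟨by omega, by omega, _, Nat.sub_lt_self one_pos (by omega), by omega,
        fun a ha => ?_, fun a ha b hb => ?_⟩
      · split_ifs with h
        · exact (hinj a (by omega) _ hlt h).symm
        · exact h2 a (lt_of_le_of_ne (by omega) fun h7 => h (by rw [h7]))
      · rcases Nat.lt_succ_iff_lt_or_eq.1 ha with h7 | rfl
        · exact h6 a h7 b hb
        · exact h5 b hb (by have := hrklt _ hlt b hb; omega)
  · rintro t s' m ht hf ⟨h1, h2, h3⟩ hc
    have f0 : s'.reg 0 = n := by rw [hf.reg 0 (by decide)]; simpa using hs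
    simp only [Expr.eval, Expr.cost, f0] at hc ht
    refine ⟨?_, fun a ha => h2 a (by omega), fun a ha => h3 a (by omega)⟩
    have e : (n + 1) * (80 * n + (1 + 1 + 1)) = 80 * (n * n) + 83 * n + 3 := by ring
    omega

/-! ### Listing the path -/

/-- Put a vertex of degree at most one, i.e. an end of the path, into register `4`. -/
def findEndpoint : Program :=
  .seq (.assign 1 (.lit 0)) <|
  .loop (.reg 1) (.reg 0) <|
    .seq (.assign 3 (.lit 0)) <|
    .seq (.assign 2 (.lit 0)) <|
    .seq (.loop (.reg 2) (.reg 0) <|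
      .seq (.assign 3 (.add (.reg 3) (.get 1 (.add (.mul (.reg 1) (.reg 0)) (.reg 2))))) <|
      .assign 2 (.add (.reg 2) (.lit 1))) <|
    .seq (.branch (.reg 3) (.lit 2) (.assign 4 (.reg 1)) .skip) <|
    .assign 1 (.add (.reg 1) (.lit 1))

theorem findEndpoint_spec {W n : ℕ} (hn : 0 < n) (hW : 10 * (n * n) + 10 ≤ W) {s : Store}
    (hs : s.reg 0 = n) (hw : ∀ b < n, ∀ j < n, s.arr 1 (b * n + j) ≤ 1)
    (hex : ∃ b < n, ∑ j ∈ Finset.range n, s.arr 1 (b * n + j) < 2) :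
    Tri W findEndpoint s fun t s' => t ≤ 200 * (n * n) ∧
      s'.reg 4 < n ∧ ∑ j ∈ Finset.range n, s.arr 1 (s'.reg 4 * n + j) < 2 := by
  have hnn : n ≤ n * n := Nat.le_mul_self n
  simp only [findEndpoint, tri_seq, tri_assign, Expr.Fits, Expr.eval, Expr.cost]
  refine ⟨by omega, ?_⟩
  refine tri_loop (fun m s' => m + s'.reg 1 = n ∧ ((∃ b < n, s'.reg 1 ≤ b ∧
      ∑ j ∈ Finset.range n, s.arr 1 (b * n + j) < 2) ∨ s'.reg 4 < n ∧
      ∑ j ∈ Finset.range n, s.arr 1 (s'.reg 4 * n + j) < 2)) (80 * n) n ?_ ?_ ?_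
  · exact ⟨by simp, .inl (by simpa using hex)⟩
  · rintro m s₁ hf ⟨h1, h2⟩
    have f0 : s₁.reg 0 = n := by rw [hf.reg 0 (by decide)]; simpa using hs
    have f1 : s₁.arr 1 = s.arr 1 := by rw [hf.arr 1 (by decide)]; simp
    simp only [tri_seq, tri_assign, Expr.Fits, Expr.eval, Expr.cost, f0]
    refine ⟨by omega, by omega, fun hlt => ⟨by omega, by omega, ?_⟩⟩
    refine tri_loop (fun m s' => m + s'.reg 2 = n ∧ s'.reg 3 ≤ s'.reg 2 ∧
        s'.reg 3 = ∑ j ∈ Finset.range (s'.reg 2), s.arr 1 (s₁.reg 1 * n + j)) 20 n ?_ ?_ ?_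
    · simp
    · rintro m s₂ hf' ⟨h3, h4, h5⟩
      have g0 : s₂.reg 0 = n := by rw [hf'.reg 0 (by decide)]; simpa using f0
      have g1 : s₂.reg 1 = s₁.reg 1 := by rw [hf'.reg 1 (by decide)]; simp
      have g2 : s₂.arr 1 = s.arr 1 := by rw [hf'.arr 1 (by decide)]; simp [f1]
      simp only [tri_seq, tri_assign, Expr.Fits, Expr.eval, Expr.cost, g0, g1, g2]
      refine ⟨by omega, by omega, fun hlt' => ?_⟩
      have := index_lt hlt hlt'
      have := hw _ hlt _ hlt'
      simp only [Store.setReg_reg, ↓reduceIte, Nat.reduceEqDiff]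
      refine ⟨by omega, by omega, by omega, m - 1, by omega, by omega, by omega, ?_⟩
      rw [Finset.sum_range_succ, h5]
    · rintro t s₂ m ht hf' ⟨h3, h4, h5⟩ hc
      have g0 : s₂.reg 0 = n := by rw [hf'.reg 0 (by decide)]; simpa using f0
      have g1 : s₂.reg 1 = s₁.reg 1 := by rw [hf'.reg 1 (by decide)]; simp
      have g4 : s₂.reg 4 = s₁.reg 4 := by rw [hf'.reg 4 (by decide)]; simp
      simp only [Expr.eval, Expr.cost, g0] at hc ht
      have e : s₂.reg 2 = n := by omega
      rw [e] at h4 h5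
      simp only [tri_branch, tri_assign, tri_skip, Expr.Fits, Expr.eval, Expr.cost,
        Store.setReg_reg, ↓reduceIte, Nat.reduceEqDiff, g1, g4]
      refine ⟨by omega, by omega, fun h6 => ⟨by omega, by omega, by omega, _,
        Nat.sub_lt_self one_pos (by omega), by omega, .inr ⟨by omega, by omega⟩⟩,
        fun h6 => ⟨by omega, by omega, _, Nat.sub_lt_self one_pos (by omega), by omega, ?_⟩⟩
      rcases h2 with ⟨b, hb, hb1, hb2⟩ | h2
      · refine .inl ⟨b, hb, ?_, hb2⟩
        have : s₁.reg 1 ≠ b := by rintro rfl; omega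
        omega
      · exact .inr h2
  · rintro t s' m ht hf ⟨h1, h2⟩ hc
    have f0 : s'.reg 0 = n := by rw [hf.reg 0 (by decide)]; simpa using hs
    simp only [Expr.eval, Expr.cost, f0] at hc ht
    refine ⟨?_, ?_⟩
    · have e : (n + 1) * (80 * n + (1 + 1 + 1)) = 80 * (n * n) + 83 * n + 3 := by ring
      omega
    · rcases h2 with ⟨b, hb, hb1, hb2⟩ | h2
      · omega
      · exact h2

/-- Walk along the path from the vertex in register `4`, and list its vertices in array `4`. The
next vertex is the neighbour different from the previous vertex, which is kept in register `5`
(initially `n`, which is no vertex). -/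
def listPath : Program :=
  .seq (.assign 5 (.reg 0)) <|
  .seq (.assign 1 (.lit 0)) <|
  .loop (.reg 1) (.reg 0) <|
    .seq (.store 4 (.reg 1) (.reg 4)) <|
    .seq (.assign 6 (.reg 4)) <|
    .seq (.assign 2 (.lit 0)) <|
    .seq (.loop (.reg 2) (.reg 0) <|
      .seq (.branch (.lit 0) (.mul (.get 1 (.add (.mul (.reg 4) (.reg 0)) (.reg 2)))
          (.add (.sub (.reg 2) (.reg 5)) (.sub (.reg 5) (.reg 2))))
        (.assign 6 (.reg 2)) .skip) <|
      .assign 2 (.add (.reg 2) (.lit 1))) <|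
    .seq (.assign 5 (.reg 4)) <|
    .seq (.assign 4 (.reg 6)) <|
    .assign 1 (.add (.reg 1) (.lit 1))

theorem listPath_spec {W n : ℕ} (hn : 0 < n) (hW : 10 * (n * n) + 10 ≤ W) {s : Store} {p : ℕ → ℕ}
    (hs : s.reg 0 = n) (hw : ∀ b < n, ∀ j < n, s.arr 1 (b * n + j) ≤ 1)
    (hlt : ∀ k < n, p k < n) (hinj : ∀ k < n, ∀ l < n, p k = p l → k = l)
    (hsurj : ∀ b < n, ∃ k < n, p k = b)
    (hadj : ∀ k < n, ∀ l < n, 0 < s.arr 1 (p k * n + p l) ↔ k + 1 = l ∨ l + 1 = k)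
    (h0 : s.reg 4 = p 0) :
    Tri W listPath s fun t s' => t ≤ 200 * (n * n) ∧ ∀ k < n, s'.arr 4 k = p k := by
  have hnn : n ≤ n * n := Nat.le_mul_self n
  simp only [listPath, tri_seq, tri_assign, Expr.Fits, Expr.eval, Expr.cost]
  refine ⟨by omega, by omega, ?_⟩
  refine tri_loop (fun m s' => m + s'.reg 1 = n ∧ s'.reg 4 < n ∧
      (s'.reg 1 < n → s'.reg 4 = p (s'.reg 1)) ∧
      s'.reg 5 = (if s'.reg 1 = 0 then n else p (s'.reg 1 - 1)) ∧
      ∀ k < s'.reg 1, s'.arr 4 k = p k) (90 * n) n ?_ ?_ ?_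
  · have := hlt 0 hn
    simp only [Store.setReg_reg]
    simp [h0, hs, this]
  · rintro m s₁ hf ⟨h1, h2, h3, h4, h5⟩
    have f0 : s₁.reg 0 = n := by rw [hf.reg 0 (by decide)]; simpa using hs
    have f1 : s₁.arr 1 = s.arr 1 := by rw [hf.arr 1 (by decide)]; simp
    simp only [tri_seq, tri_store, tri_assign, Expr.Fits, Expr.eval, Expr.cost, f0]
    refine ⟨by omega, by omega, fun hk => ?_⟩
    have h3' := h3 hk
    simp only [Store.setArr_reg]
    refine ⟨by omega, by omega, by omega, by omega, ?_⟩
    have h5n : s₁.reg 5 ≤ n := by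
      rw [h4]; split_ifs
      · exact le_rfl
      · exact (hlt _ (by omega)).le
    -- the test succeeds only for the neighbour that is not the previous vertex
    have hcand : ∀ b < n, 0 < s.arr 1 (s₁.reg 4 * n + b) * (b - s₁.reg 5 + (s₁.reg 5 - b)) ↔
        s₁.reg 1 + 1 < n ∧ b = p (s₁.reg 1 + 1) := by
      intro b hb
      obtain ⟨l, hl, rfl⟩ := hsurj b hb
      rw [Nat.pos_iff_ne_zero, mul_ne_zero_iff, ← Nat.pos_iff_ne_zero, ← Nat.pos_iff_ne_zero, h3', hadj _ hk _ hl]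
      have h6 : 0 < p l - s₁.reg 5 + (s₁.reg 5 - p l) ↔ p l ≠ s₁.reg 5 := by omega
      rw [h6, h4]
      constructor
      · rintro ⟨rfl | h7, h8⟩
        · exact ⟨hl, rfl⟩
        · rw [← h7] at h8; simp at h8
      · rintro ⟨h7, h8⟩
        have h9 := hinj _ hl _ h7 h8
        refine ⟨.inl h9.symm, ?_⟩
        split_ifs with h10
        · have := hlt l hl; omega
        · intro h11
          have := hinj _ hl _ (by omega) h11
          omega
    refine tri_loop (fun m s' => m + s'.reg 2 = n ∧ s'.reg 6 < n ∧ (s₁.reg 1 + 1 < n →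
        p (s₁.reg 1 + 1) < s'.reg 2 → s'.reg 6 = p (s₁.reg 1 + 1))) 30 n ?_ ?_ ?_
    · simpa using h2
    · rintro m s₂ hf' ⟨h6, h7, h8⟩
      have g0 : s₂.reg 0 = n := by rw [hf'.reg 0 (by decide)]; simpa using f0
      have g4 : s₂.reg 4 = s₁.reg 4 := by rw [hf'.reg 4 (by decide)]; simp
      have g5 : s₂.reg 5 = s₁.reg 5 := by rw [hf'.reg 5 (by decide)]; simp
      have g1 : s₂.arr 1 = s.arr 1 := by rw [hf'.arr 1 (by decide)]; simp [f1]
      simp only [tri_seq, tri_branch, tri_skip, tri_assign, Expr.Fits, Expr.eval, Expr.cost,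
        g0, g1, g4, g5, Store.setReg_reg, ↓reduceIte, Nat.reduceEqDiff]
      refine ⟨by omega, by omega, fun hlt' => ?_⟩
      have := index_lt h2 hlt'
      have h9 : s.arr 1 (s₁.reg 4 * n + s₂.reg 2) ≤ 1 := hw _ h2 _ hlt'
      have h10 := Nat.mul_le_mul_right (s₂.reg 2 - s₁.reg 5 + (s₁.reg 5 - s₂.reg 2)) h9
      have h11 := hcand _ hlt'
      refine ⟨by omega, ⟨by omega, by omega, by omega⟩, fun h12 => ?_, fun h12 => ?_⟩
      · obtain ⟨h13, h14⟩ := h11.1 h12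
        exact ⟨by omega, by omega, by omega, m - 1, by omega, by omega, by omega,
          fun _ _ => h14⟩
      · refine ⟨by omega, by omega, m - 1, by omega, by omega, by omega, fun h13 h14 => ?_⟩
        have : s₂.reg 2 ≠ p (s₁.reg 1 + 1) := fun h15 => h12 (h11.2 ⟨h13, h15⟩)
        exact h8 h13 (by omega)
    · rintro t s₂ m ht hf' ⟨h6, h7, h8⟩ hc
      have g0 : s₂.reg 0 = n := by rw [hf'.reg 0 (by decide)]; simpa using f0
      have g1 : s₂.reg 1 = s₁.reg 1 := by rw [hf'.reg 1 (by decide)]; simp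
      have g4 : s₂.reg 4 = s₁.reg 4 := by rw [hf'.reg 4 (by decide)]; simp
      have g3 : s₂.arr 4 = Function.update (s₁.arr 4) (s₁.reg 1) (s₁.reg 4) := by
        rw [hf'.arr 4 (by decide)]; simp
      simp only [Expr.eval, Expr.cost, g0] at hc ht
      simp only [Store.setReg_reg, Store.setReg_arr, ↓reduceIte,
        Nat.reduceEqDiff, g1, g3, g4]
      refine ⟨by omega, by omega, by omega, by omega, _, Nat.sub_lt_self one_pos (by omega),
        by omega, h7, fun h9 => h8 h9 (by have := hlt _ h9; omega), ?_, fun k hk' => ?_⟩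
      · rw [Nat.add_sub_cancel, h3']
      · rw [Function.update_apply]
        split_ifs with h9
        · rw [h9, h3']
        · exact h5 k (by omega)
  · rintro t s' m ht hf ⟨h1, h2, h3, h4, h5⟩ hc
    have f0 : s'.reg 0 = n := by rw [hf.reg 0 (by decide)]; simpa using hs
    simp only [Expr.eval, Expr.cost, f0] at hc ht
    refine ⟨?_, fun k hk => h5 k (by omega)⟩
    have e : (n + 1) * (90 * n + (1 + 1 + 1)) = 90 * (n * n) + 93 * n + 3 := by ring
    omega

/-! ### Walk ranges -/

/-- Compute the walk ranges of the agents, for agent `k` the right end in cell `k` of array `7` and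
the left end in cell `k` of array `8`. -/
def walkRanges : Program :=
  .seq (.assign 1 (.lit 0)) <|
  .loop (.reg 1) (.reg 0) <|
    .seq (.assign 4 (.mul (.get 5 (.get 4 (.reg 1))) (.reg 0))) <|
    .seq (.assign 2 (.reg 1)) <|
    .seq (.assign 3 (.reg 1)) <|
    .seq (.loop (.add (.reg 2) (.lit 1)) (.reg 0) <|
      .seq (.branch (.get 6 (.add (.reg 4) (.get 4 (.add (.reg 2) (.lit 1)))))
          (.get 6 (.add (.reg 4) (.get 4 (.reg 2))))
        (.branch (.reg 2) (.add (.reg 3) (.lit 1)) (.assign 3 (.add (.reg 2) (.lit 1))) .skip)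
        .skip) <|
      .assign 2 (.add (.reg 2) (.lit 1))) <|
    .seq (.store 7 (.reg 1) (.reg 3)) <|
    .seq (.assign 2 (.reg 1)) <|
    .seq (.assign 3 (.reg 1)) <|
    .seq (.loop (.lit 0) (.reg 2) <|
      .seq (.branch (.get 6 (.add (.reg 4) (.get 4 (.sub (.reg 2) (.lit 1)))))
          (.get 6 (.add (.reg 4) (.get 4 (.reg 2))))
        (.branch (.reg 3) (.add (.reg 2) (.lit 1)) (.assign 3 (.sub (.reg 2) (.lit 1))) .skip)
        .skip) <|
      .assign 2 (.sub (.reg 2) (.lit 1))) <|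
    .seq (.store 8 (.reg 1) (.reg 3)) <|
    .assign 1 (.add (.reg 1) (.lit 1))

/-- What the programs assume about the tables: `p` lists the positions' objects along the path
(array `4`), `g k` is the agent starting at position `k` (read off array `5`), and `r k x` is the
rank of position `x` for that agent (read off array `6`). -/
structure Tables (n : ℕ) (r : ℕ → ℕ → ℕ) (p g : ℕ → ℕ) (s : Store) : Prop where
  size : s.reg 0 = n
  path : ∀ k < n, s.arr 4 k = p k
  path_lt : ∀ k < n, p k < n
  agent : ∀ k < n, s.arr 5 (p k) = g k
  agent_lt : ∀ k < n, g k < n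
  rank : ∀ k < n, ∀ x < n, s.arr 6 (g k * n + p x) = r k x
  rank_lt : ∀ k < n, ∀ x < n, r k x < n

theorem Tables.congr {n : ℕ} {r : ℕ → ℕ → ℕ} {p g : ℕ → ℕ} {s s' : Store} (h : Tables n r p g s)
    (h0 : s'.reg 0 = s.reg 0) (h4 : s'.arr 4 = s.arr 4) (h5 : s'.arr 5 = s.arr 5)
    (h6 : s'.arr 6 = s.arr 6) : Tables n r p g s' := by
  obtain ⟨a, b, c, d, e, f, g⟩ := h
  constructor <;> simpa only [h0, h4, h5, h6]

theorem walkRanges_spec {W n : ℕ} (hn : 0 < n) (hW : 10 * (n * n) + 10 ≤ W) {s : Store}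
    {r : ℕ → ℕ → ℕ} {p g : ℕ → ℕ} (hT : Tables n r p g s) :
    Tri W walkRanges s fun t s' => t ≤ 400 * (n * n) ∧
      IsWalkRange n r (s'.arr 8) (s'.arr 7) := by
  have hnn : n ≤ n * n := Nat.le_mul_self n
  simp only [walkRanges, tri_seq, tri_assign, Expr.Fits, Expr.eval, Expr.cost]
  refine ⟨by omega, ?_⟩
  refine tri_loop (fun m s' => m + s'.reg 1 = n ∧
      (∀ k < s'.reg 1, s'.arr 8 k ≤ k ∧ (∀ y, s'.arr 8 k ≤ y → y < k → r k y < r k (y + 1)) ∧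
        ∀ y, y + 1 = s'.arr 8 k → ¬ r k y < r k (y + 1)) ∧
      ∀ k < s'.reg 1, k ≤ s'.arr 7 k ∧ s'.arr 7 k < n ∧
        (∀ y, k ≤ y → y < s'.arr 7 k → r k (y + 1) < r k y) ∧
        (s'.arr 7 k + 1 < n → ¬ r k (s'.arr 7 k + 1) < r k (s'.arr 7 k))) (190 * n) n ?_ ?_ ?_
  · simp
  · rintro m s₁ hf ⟨h1, h2, h3⟩
    have T₁ : Tables n r p g s₁ := hT.congr (by rw [hf.reg 0 (by decide)]; simp)
      (by rw [hf.arr 4 (by decide)]; simp) (by rw [hf.arr 5 (by decide)]; simp)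
      (by rw [hf.arr 6 (by decide)]; simp)
    generalize hk' : s₁.reg 1 = k at *
    simp only [tri_seq, tri_assign, Expr.Fits, Expr.eval, Expr.cost, T₁.size, hk']
    refine ⟨by omega, by omega, fun hk => ?_⟩
    have := T₁.path_lt k hk
    have := T₁.agent_lt k hk
    have := index_lt (T₁.agent_lt k hk) hn
    simp only [Store.setReg_reg, T₁.path k hk, T₁.agent k hk, hk', ↓reduceIte,
      OfNat.one_ne_ofNat]
    refine ⟨by omega, by omega, by omega, ?_⟩
    refine tri_loop (fun m s' => m + s'.reg 2 = n ∧ k ≤ s'.reg 3 ∧ s'.reg 3 ≤ s'.reg 2 ∧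
        s'.reg 2 < n ∧ (∀ y, k ≤ y → y < s'.reg 3 → r k (y + 1) < r k y) ∧
        (s'.reg 3 ≠ s'.reg 2 → ¬ r k (s'.reg 3 + 1) < r k (s'.reg 3))) 40 (n - k) ?_ ?_ ?_
    · simp only [Store.setReg_reg, ↓reduceIte, Nat.reduceEqDiff]
      exact ⟨by omega, by omega, by omega, hk, fun y hy hy' => by omega, fun h => absurd rfl h⟩
    · rintro m s₂ hf' ⟨h4, h5, h6, h7, h8, h9⟩
      have g4 : s₂.reg 4 = g k * n := by rw [hf'.reg 4 (by decide)]; simp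
      have T₂ : Tables n r p g s₂ := T₁.congr (by rw [hf'.reg 0 (by decide)]; simp)
        (by rw [hf'.arr 4 (by decide)]; simp) (by rw [hf'.arr 5 (by decide)]; simp)
        (by rw [hf'.arr 6 (by decide)]; simp)
      simp only [tri_seq, tri_branch, tri_skip, tri_assign, Expr.Fits, Expr.eval, Expr.cost,
        T₂.size, g4]
      refine ⟨by omega, by omega, fun hx => ?_⟩
      have a1 := T₂.path_lt _ hx
      have a2 := T₂.path_lt _ h7
      have a3 := index_lt (T₁.agent_lt k hk) a1
      have a4 := index_lt (T₁.agent_lt k hk) a2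
      have a5 := T₂.rank_lt k hk _ hx
      have a6 := T₂.rank_lt k hk _ h7
      simp only [T₂.path _ hx, T₂.path _ h7, T₂.rank k hk _ hx, T₂.rank k hk _ h7,
        Store.setReg_reg, ↓reduceIte, Nat.reduceEqDiff]
      refine ⟨by omega, by omega, fun h10 => ⟨by omega, by omega, fun h11 => ?_, fun h11 => ?_⟩,
        fun h10 => ?_⟩
      · refine ⟨by omega, by omega, by omega, m - 1, by omega, by omega, by omega, by omega,
          by omega, fun y hy hy' => ?_, fun h12 => absurd rfl h12⟩
        by_cases h13 : y < s₂.reg 3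
        · exact h8 y hy h13
        · obtain rfl : y = s₂.reg 2 := by omega
          exact h10
      · exact ⟨by omega, by omega, m - 1, by omega, by omega, by omega, by omega, by omega, h8,
          fun _ => h9 (by omega)⟩
      · refine ⟨by omega, by omega, m - 1, by omega, by omega, by omega, by omega, by omega, h8,
          fun _ => ?_⟩
        by_cases h12 : s₂.reg 3 = s₂.reg 2
        · rw [h12]; exact h10
        · exact h9 h12
    rintro t₂ s₂ m ht₂ hf₂ ⟨h4, h5, h6, h7, h8, h9⟩ hc₂
    have T₂ : Tables n r p g s₂ := T₁.congr (by rw [hf₂.reg 0 (by decide)]; simp)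
      (by rw [hf₂.arr 4 (by decide)]; simp) (by rw [hf₂.arr 5 (by decide)]; simp)
      (by rw [hf₂.arr 6 (by decide)]; simp)
    have g1 : s₂.reg 1 = k := by rw [hf₂.reg 1 (by decide)]; simpa using hk'
    have g4 : s₂.reg 4 = g k * n := by rw [hf₂.reg 4 (by decide)]; simp
    have g7 : s₂.arr 7 = s₁.arr 7 := by rw [hf₂.arr 7 (by decide)]; simp
    have g8 : s₂.arr 8 = s₁.arr 8 := by rw [hf₂.arr 8 (by decide)]; simp
    simp only [Expr.eval, Expr.cost, T₂.size] at hc₂ ht₂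
    simp only [tri_store, Expr.Fits, Expr.eval, Expr.cost, g1, Store.setArr_reg]
    refine ⟨by omega, by omega, by omega, by omega, ?_⟩
    refine tri_loop (fun m s' => m = s'.reg 2 ∧ s'.reg 3 ≤ k ∧ s'.reg 2 ≤ s'.reg 3 ∧
        (∀ y, s'.reg 3 ≤ y → y < k → r k y < r k (y + 1)) ∧
        (s'.reg 3 ≠ s'.reg 2 → ∀ y, y + 1 = s'.reg 3 → ¬ r k y < r k (y + 1))) 40 k ?_ ?_ ?_
    · simp only [Store.setReg_reg, ↓reduceIte, Nat.reduceEqDiff]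
      exact ⟨trivial, by omega, by omega, fun y hy hy' => by omega, fun h => absurd rfl h⟩
    · rintro m s₃ hf' ⟨h10, h11, h12, h13, h14⟩
      have g4' : s₃.reg 4 = g k * n := by rw [hf'.reg 4 (by decide)]; simp [g4]
      have T₃ : Tables n r p g s₃ := T₂.congr (by rw [hf'.reg 0 (by decide)]; simp)
        (by rw [hf'.arr 4 (by decide)]; simp) (by rw [hf'.arr 5 (by decide)]; simp)
        (by rw [hf'.arr 6 (by decide)]; simp)
      simp only [tri_seq, tri_branch, tri_skip, tri_assign, Expr.Fits, Expr.eval, Expr.cost, g4']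
      refine ⟨by omega, by omega, fun hx => ?_⟩
      have b1 : s₃.reg 2 < n := by omega
      have b2 : s₃.reg 2 - 1 < n := by omega
      have a1 := T₃.path_lt _ b1
      have a2 := T₃.path_lt _ b2
      have a3 := index_lt (T₁.agent_lt k hk) a1
      have a4 := index_lt (T₁.agent_lt k hk) a2
      have a5 := T₃.rank_lt k hk _ b1
      have a6 := T₃.rank_lt k hk _ b2
      simp only [T₃.path _ b1, T₃.path _ b2, T₃.rank k hk _ b1, T₃.rank k hk _ b2,
        Store.setReg_reg, ↓reduceIte, Nat.reduceEqDiff]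
      have b3 : s₃.reg 2 - 1 + 1 = s₃.reg 2 := by omega
      refine ⟨by omega, by omega, fun h10 => ⟨by omega, by omega, fun h15 => ?_, fun h15 => ?_⟩,
        fun h10 => ?_⟩
      · refine ⟨by omega, by omega, by omega, m - 1, by omega, by omega, by omega, by omega,
          fun y hy hy' => ?_, fun h12 => absurd rfl h12⟩
        by_cases h16 : s₃.reg 3 ≤ y
        · exact h13 y h16 hy'
        · obtain rfl : y = s₃.reg 2 - 1 := by omega
          rw [b3]; exact h10
      · exact ⟨by omega, by omega, m - 1, by omega, by omega, by omega, by omega, h13,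
          fun _ => h14 (by omega)⟩
      · refine ⟨by omega, by omega, m - 1, by omega, by omega, by omega, by omega, h13,
          fun _ => ?_⟩
        by_cases h16 : s₃.reg 3 = s₃.reg 2
        · intro y hy
          obtain rfl : y = s₃.reg 2 - 1 := by omega
          rw [b3]; exact h10
        · exact h14 h16
    rintro t₃ s₃ m ht₃ hf₃ ⟨h10, h11, h12, h13, h14⟩ hc₃
    have g1' : s₃.reg 1 = k := by rw [hf₃.reg 1 (by decide)]; simpa using g1
    have g7' : s₃.arr 7 = Function.update (s₁.arr 7) k (s₂.reg 3) := by
      rw [hf₃.arr 7 (by decide)]; simp [g7]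
    have g8' : s₃.arr 8 = s₁.arr 8 := by rw [hf₃.arr 8 (by decide)]; simp [g8]
    simp only [Expr.eval, Expr.cost] at hc₃ ht₃
    simp only [g1', g7', g8', Store.setReg_arr, Store.setArr_arr, Nat.reduceEqDiff, ↓reduceIte]
    refine ⟨by omega, by omega, by omega, by omega, _, Nat.sub_lt_self one_pos (by omega),
      by omega, fun l hl => ?_, fun l hl => ?_⟩
    · rcases Nat.lt_succ_iff_lt_or_eq.1 hl with h15 | rfl
      · rw [Function.update_of_ne (by omega)]; exact h2 l h15
      · rw [Function.update_self]
        refine ⟨h11, h13, ?_⟩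
        by_cases h16 : s₃.reg 3 = s₃.reg 2
        · intro y hy; omega
        · exact h14 h16
    · rcases Nat.lt_succ_iff_lt_or_eq.1 hl with h15 | rfl
      · rw [Function.update_of_ne (by omega)]; exact h3 l h15
      · rw [Function.update_self]
        exact ⟨h5, by omega, h8, fun h16 => h9 (by omega)⟩
  · rintro t s' m ht hf ⟨h1, h2, h3⟩ hc
    have f0 : s'.reg 0 = n := by rw [hf.reg 0 (by decide)]; simpa using hT.size
    simp only [Expr.eval, Expr.cost, f0] at hc ht
    refine ⟨?_, ?_⟩
    · have e : (n + 1) * (190 * n + (1 + 1 + 1)) = 190 * (n * n) + 193 * n + 3 := by ring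
      omega
    · have h4 : ∀ k < n, k < s'.reg 1 := fun k hk => by omega
      exact ⟨fun k hk => (h2 k (h4 k hk)).1, fun k hk => (h2 k (h4 k hk)).2.1,
        fun k hk => (h2 k (h4 k hk)).2.2, fun k hk => (h3 k (h4 k hk)).1,
        fun k hk => (h3 k (h4 k hk)).2.1, fun k hk => (h3 k (h4 k hk)).2.2.1,
        fun k hk => (h3 k (h4 k hk)).2.2.2⟩

/-! ### The invariant of the search for the best positions -/

/-- The holes stored in the cells `i, …, j - 1` of the array `q`. -/
def holes (q : ℕ → ℕ) (i j : ℕ) : List ℕ := (List.range' i (j - i)).map q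

section holes

variable {q q' : ℕ → ℕ} {i j l : ℕ}

theorem length_holes : (holes q i j).length = j - i := by simp [holes]

theorem holes_of_le (h : j ≤ i) : holes q i j = [] := by
  simp [holes, Nat.sub_eq_zero_of_le h]

theorem holes_cons (h : i < j) : holes q i j = q i :: holes q (i + 1) j := by
  obtain ⟨d, rfl⟩ : ∃ d, j = i + 1 + d := ⟨j - i - 1, by omega⟩
  have e : i + 1 + d - i = d + 1 := by omega
  simp [holes, e, List.range'_succ]

theorem holes_append (h : i ≤ j) (h' : j ≤ l) : holes q i j ++ holes q j l = holes q i l := by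
  obtain ⟨d, rfl⟩ : ∃ d, j = i + d := ⟨j - i, by omega⟩
  obtain ⟨d', rfl⟩ : ∃ d', l = i + d + d' := ⟨l - (i + d), by omega⟩
  have e : i + d + d' - i = d + d' := by omega
  have := List.range'_append (s := i) (m := d) (n := d') (step := 1)
  simp only [one_mul] at this
  rw [holes, holes, holes, e, ← this, List.map_append, Nat.add_sub_cancel_left,
    Nat.add_sub_cancel_left]

theorem holes_congr (h : ∀ x, i ≤ x → x < j → q' x = q x) : holes q' i j = holes q i j := by
  refine List.map_congr_left fun x hx => h x ?_ ?_ <;> simp [List.mem_range'_1] at hx <;> omega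

theorem holes_eq_range' {m : ℕ} (h : ∀ x < j - i, q (i + x) = m + x) :
    holes q i j = List.range' m (j - i) := by
  refine List.ext_getElem (by simp [holes]) fun x hx hx' => ?_
  simp only [holes, List.length_map, List.length_range'] at hx
  simp [holes, h x hx]

end holes

theorem IsWalkRange.rank_lt {n : ℕ} {r : ℕ → ℕ → ℕ} {L R : ℕ → ℕ} (h : IsWalkRange n r L R)
    {k x y : ℕ} (hk : k < n) (hx : k ≤ x) (hxy : x < y) (hy : y ≤ R k) : r k y < r k x := by
  induction y, hxy using Nat.le_induction with
  | base => exact h.right_step k hk x hx hy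
  | succ y hxy ih =>
    have := h.right_step k hk y (by omega) hy
    have := ih (by omega)
    omega

/-- The rank that agent `k` has to beat by moving right: that of the first hole, if `k` can take
it, and otherwise `n`, which is worse than all ranks. -/
def threshold (n : ℕ) (r : ℕ → ℕ → ℕ) (L q : ℕ → ℕ) (k m hd : ℕ) : ℕ :=
  if k < m ∧ L k ≤ q hd then r k (q hd) else n

/-- The invariant of the search. The agents before `k` have made the best choices `f`, which leads
to the bound `m` and the holes stored in the queue `q` from cell `hd` on. Agent `k` considers
moving right to position `b`, and the positions from `m` to `b - 1` have already been appended to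
the queue. The flag `c` tells whether agent `k` will move right: if `c = 0`, then the targets
before `b` are worse than the first hole; otherwise moving to `b - 1` is possible, and better than
the first hole. -/
structure SearchInv (n : ℕ) (r : ℕ → ℕ → ℕ) (L R q f : ℕ → ℕ) (k m hd b c : ℕ) : Prop where
  k_le : k ≤ n
  hd_le : hd ≤ k
  le_bound : k ≤ m
  bound_le : m ≤ b
  le_size : b ≤ n
  flag_le : c ≤ 1
  chain : LineChain L R f k (holes q hd (hd + m - k), m)
  best : IsBestChain n r L R f k
  completable : Completable n L R k (holes q hd (hd + m - k), m)
  tail : ∀ t, m ≤ t → t < b → q (hd + t - k) = t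
  uncommitted : c = 0 → ∀ t, m ≤ t → t < b → threshold n r L q k m hd < r k t
  committed : c ≠ 0 → m < b ∧ b - 1 ≤ R k ∧ r k (b - 1) < threshold n r L q k m hd ∧
    Completable n L R (k + 1) (holes q hd (hd + m - k) ++ List.range' m (b - 1 - m), b)

namespace SearchInv

variable {n : ℕ} {r : ℕ → ℕ → ℕ} {L R q f : ℕ → ℕ} {k m hd b c : ℕ}

theorem init (h : IsWalkRange n r L R) : SearchInv n r L R q f 0 0 0 0 0 where
  k_le := by omega
  hd_le := by omega
  le_bound := by omega
  bound_le := by omega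
  le_size := by omega
  flag_le := by omega
  chain := .zero
  best := fun j hj => by omega
  completable := completable_nil h.le_right (by omega)
  tail := fun t _ ht => by omega
  uncommitted := fun _ t _ ht => by omega
  committed := fun h => absurd rfl h

theorem holes_eq (hI : SearchInv n r L R q f k m hd b c) {a : ℕ} (ha : m ≤ a) (hab : a ≤ b) :
    holes q hd (hd + a - k) = holes q hd (hd + m - k) ++ List.range' m (a - m) := by
  have h1 := hI.le_bound
  rw [← holes_append (j := hd + m - k) (by omega) (by omega)]
  congr 1
  have e : hd + a - k - (hd + m - k) = a - m := by omega
  rw [holes_eq_range' (m := m), e]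
  intro x hx
  rw [← hI.tail (m + x) (by omega) (by omega)]
  rw [show hd + (m + x) - k = hd + m - k + x by omega]

theorem first_lt (hI : SearchInv n r L R q f k m hd b c) (hkm : k < m) : q hd < m := by
  have := hI.chain.wf.lt
  simp only at this
  rw [holes_cons (by omega)] at this
  exact this _ (by simp)

/-- Appending a position to the queue does not affect the holes before it. -/
theorem holes_update (hI : SearchInv n r L R q f k m hd b c) :
    holes (Function.update q (hd + b - k) b) hd (hd + m - k) = holes q hd (hd + m - k) := by
  have h1 := hI.le_bound
  have h2 := hI.bound_le
  exact holes_congr fun x _ hx => Function.update_of_ne (by omega) _ _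

theorem threshold_update (hI : SearchInv n r L R q f k m hd b c) :
    threshold n r L (Function.update q (hd + b - k) b) k m hd = threshold n r L q k m hd := by
  have h1 := hI.le_bound
  have h2 := hI.bound_le
  unfold threshold
  by_cases h : k < m
  · rw [Function.update_of_ne (by omega)]
  · rw [if_neg (by tauto), if_neg (by tauto)]

theorem tail_update (hI : SearchInv n r L R q f k m hd b c) (t : ℕ) (ht : m ≤ t)
    (htb : t < b + 1) : Function.update q (hd + b - k) b (hd + t - k) = t := by
  have h1 := hI.le_bound
  by_cases h : t = b
  · subst h; simp
  · rw [Function.update_of_ne (by omega)]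
    exact hI.tail t ht (by omega)

/-- A target worse than the first hole is skipped. -/
theorem skip (hI : SearchInv n r L R q f k m hd b c) (h : IsWalkRange n r L R) (hk : k < n)
    (hbR : b ≤ R k) (hb : threshold n r L q k m hd < r k b) :
    SearchInv n r L R (Function.update q (hd + b - k) b) f k m hd (b + 1) c where
  k_le := hI.k_le
  hd_le := hI.hd_le
  le_bound := hI.le_bound
  bound_le := by have := hI.bound_le; omega
  le_size := by have := h.right_lt k hk; omega
  flag_le := hI.flag_le
  chain := by rw [hI.holes_update]; exact hI.chain
  best := hI.best
  completable := by rw [hI.holes_update]; exact hI.completable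
  tail := hI.tail_update
  uncommitted := fun hc t ht htb => by
    rw [hI.threshold_update]
    rcases Nat.lt_succ_iff_lt_or_eq.1 htb with h1 | rfl
    · exact hI.uncommitted hc t ht h1
    · exact hb
  committed := fun hc => by
    -- further to the right it only gets better
    obtain ⟨h1, h2, h3, -⟩ := hI.committed hc
    have h4 := hI.le_bound
    have := h.rank_lt hk (x := b - 1) (y := b) (by omega) (by omega) hbR
    omega

theorem accept (hI : SearchInv n r L R q f k m hd b c) (h : IsWalkRange n r L R)
    (hinj : ∀ k < n, ∀ x < n, ∀ y < n, r k x = r k y → x = y)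
    (hlt : ∀ k < n, ∀ x < n, r k x < n) (hk : k < n)
    (hbR : b ≤ R k) (hb : ¬ threshold n r L q k m hd < r k b)
    (hc : Completable n L R (k + 1) (holes q hd (hd + b - k), b + 1)) :
    SearchInv n r L R (Function.update q (hd + b - k) b) f k m hd (b + 1) 1 where
  k_le := hI.k_le
  hd_le := hI.hd_le
  le_bound := hI.le_bound
  bound_le := by have := hI.bound_le; omega
  le_size := by have := h.right_lt k hk; omega
  flag_le := le_rfl
  chain := by rw [hI.holes_update]; exact hI.chain
  best := hI.best
  completable := by rw [hI.holes_update]; exact hI.completable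
  tail := hI.tail_update
  uncommitted := fun hc => absurd hc one_ne_zero
  committed := fun _ => by
    have h1 := hI.bound_le
    have h2 := h.right_lt k hk
    rw [hI.threshold_update, hI.holes_update, Nat.add_sub_cancel, ← hI.holes_eq h1 le_rfl]
    refine ⟨by omega, hbR, lt_of_le_of_ne (not_lt.1 hb) ?_, hc⟩
    unfold threshold
    split_ifs with h3
    · intro h4
      have h5 := hI.first_lt h3.1
      have := hinj k hk b (by omega) _ (by omega) h4
      omega
    · exact (hlt k hk b (by omega)).ne

/-- If moving to `b` is impossible, then so is moving further. -/
theorem lt_of_push (hI : SearchInv n r L R q f k m hd b c) (h : IsWalkRange n r L R)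
    (hfail : ¬ (b ≤ R k ∧ Completable n L R (k + 1) (holes q hd (hd + b - k), b + 1))) {v : ℕ}
    (hvR : v ≤ R k)
    (hc : Completable n L R (k + 1)
      (holes q hd (hd + m - k) ++ List.range' m (v - m), v + 1)) : v < b := by
  by_contra hbv
  have h1 := hI.le_bound
  refine hfail ⟨by omega, ?_⟩
  rw [hI.holes_eq hI.bound_le le_rfl]
  exact completable_push_of_le h.le_right (by rw [length_holes]; omega) hI.bound_le (by omega) hc

/-- The choice of agent `k` extends a chain of best choices. -/
theorem best_succ (hI : SearchInv n r L R q f k m hd b c) {w : ℕ}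
    (hw : ∀ v S', LineStep L R k v (holes q hd (hd + m - k), m) S' →
      Completable n L R (k + 1) S' → v = w ∨ r k w < r k v) :
    IsBestChain n r L R (Function.update f k w) (k + 1) := by
  have hupd : ∀ j < k, Function.update f k w j = f j := fun j hj =>
    Function.update_of_ne (by omega) _ _
  intro j hj S hS v S' hs hc
  rcases Nat.lt_succ_iff_lt_or_eq.1 hj with h1 | rfl
  · rw [hupd j h1]
    exact hI.best j h1 S (hS.congr fun i hi => (hupd i (by omega)).symm) v S' hs hc
  · rw [Function.update_self]
    obtain rfl := (hS.congr fun i hi => (hupd i hi).symm).unique hI.chain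
    exact hw v S' hs hc

/-- If agent `k` is not committed and the next target is impossible, then the first hole is its best
choice. In particular there is a hole that it can take, since the state is completable. -/
theorem pop (hI : SearchInv n r L R q f k m hd b 0) (h : IsWalkRange n r L R)
    (hlt : ∀ k < n, ∀ x < n, r k x < n) (hk : k < n)
    (hfail : ¬ (b ≤ R k ∧ Completable n L R (k + 1) (holes q hd (hd + b - k), b + 1))) :
    k < m ∧ SearchInv n r L R q (Function.update f k (q hd)) (k + 1) m (hd + 1) m 0 := by
  have h1 := hI.le_bound
  have h2 := hI.bound_le
  have h3 := hI.le_size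
  have h4 := hI.hd_le
  have hunc := hI.uncommitted rfl
  have hpop : k < m ∧ L k ≤ q hd := by
    by_contra hcon
    have hth : threshold n r L q k m hd = n := if_neg hcon
    have hcomp := hI.completable
    generalize hQ : holes q hd (hd + m - k) = Q at hcomp
    cases hcomp with
    | done => omega
    | @step _ v _ _ _ hs hc =>
      cases hs with
      | pop hL =>
        have hkm : k < m := by
          by_contra h5
          rw [holes_of_le (by omega)] at hQ
          simp at hQ
        rw [holes_cons (by omega)] at hQ
        obtain ⟨rfl, -⟩ := List.cons.inj hQ
        exact hcon ⟨hkm, hL⟩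
      | push hm hv =>
        rw [← hQ] at hc
        have h5 := hI.lt_of_push h hfail hv hc
        have := hunc v hm h5
        have := hlt k hk v (by omega)
        omega
  have hth : threshold n r L q k m hd = r k (q hd) := if_pos hpop
  have hcons : holes q hd (hd + m - k) = q hd :: holes q (hd + 1) (hd + 1 + m - (k + 1)) := by
    rw [holes_cons (by omega)]; congr 2; omega
  have hwf := hI.chain.wf
  have hchain := hI.chain
  have hcomp := hI.completable
  rw [hcons] at hwf hchain hcomp
  refine ⟨hpop.1, ⟨by omega, by omega, by omega, le_rfl, by omega, by omega, ?_, hI.best_succ ?_, ?_,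
    fun t _ _ => by omega, fun _ t _ _ => by omega, fun h => absurd rfl h⟩⟩
  · refine .succ (hchain.congr fun j hj => Function.update_of_ne (by omega) _ _) ?_
    rw [Function.update_self]
    exact .pop hpop.2
  · intro v S' hs hc
    rw [← hth]
    generalize hQ : holes q hd (hd + m - k) = Q at hs
    cases hs with
    | pop hL =>
      rw [hcons] at hQ
      exact .inl (List.cons.inj hQ).1.symm
    | push hm hv =>
      rw [← hQ] at hc
      exact .inr (hunc v hm (hI.lt_of_push h hfail hv hc))
  · exact (completable_cons_iff_pop h.le_right hk hwf hpop.2).1 hcomp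

/-- If agent `k` is committed and the next target is impossible, then the last accepted target is its
best choice. -/
theorem push (hI : SearchInv n r L R q f k m hd b c) (h : IsWalkRange n r L R) (hc : c ≠ 0)
    (hk : k < n)
    (hfail : ¬ (b ≤ R k ∧ Completable n L R (k + 1) (holes q hd (hd + b - k), b + 1))) :
    m < b ∧ SearchInv n r L R q (Function.update f k (b - 1)) (k + 1) b hd b 0 := by
  have h1 := hI.le_bound
  have h2 := hI.bound_le
  have h3 := hI.le_size
  have h4 := hI.hd_le
  obtain ⟨hmb, hbR, hbt, hcomp⟩ := hI.committed hc
  have e : holes q hd (hd + b - (k + 1)) =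
      holes q hd (hd + m - k) ++ List.range' m (b - 1 - m) := by
    rw [← hI.holes_eq (by omega) (by omega)]; congr 1; omega
  refine ⟨hmb, ⟨by omega, by omega, by omega, le_rfl, by omega, by omega, ?_, hI.best_succ ?_, ?_,
    fun t _ _ => by omega, fun _ t _ _ => by omega, fun h => absurd rfl h⟩⟩
  · refine .succ (hI.chain.congr fun j hj => Function.update_of_ne (by omega) _ _) ?_
    rw [Function.update_self, e]
    have := LineStep.push (L := L) (Q := holes q hd (hd + m - k)) (m := m) (by omega) hbR
    rwa [Nat.sub_add_cancel (by omega)] at this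
  · intro v S' hs hc
    generalize hQ : holes q hd (hd + m - k) = Q at hs
    cases hs with
    | pop hL =>
      have hkm : k < m := by
        by_contra h5
        rw [holes_of_le (by omega)] at hQ
        simp at hQ
      rw [holes_cons (by omega)] at hQ
      obtain ⟨rfl, -⟩ := List.cons.inj hQ
      have hth : threshold n r L q k m hd = r k (q hd) := if_pos ⟨hkm, hL⟩
      exact .inr (hth ▸ hbt)
    | push hm hv =>
      rw [← hQ] at hc
      have h5 := hI.lt_of_push h hfail hv hc
      by_cases h6 : v = b - 1
      · exact .inl h6
      · exact .inr (h.rank_lt hk (by omega) (by omega) hbR)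
  · rw [e]; exact hcomp

end SearchInv

/-! ### The search program -/

/-- The rank of the position `e` for the agent that starts at position `k` (in register `1`). -/
abbrev rankExpr (e : Expr) : Expr :=
  .get 6 (.add (.mul (.get 5 (.get 4 (.reg 1))) (.reg 0)) (.get 4 e))

/-- The cell of the queue behind the last stored hole. -/
abbrev queueEnd : Expr := .sub (.add (.reg 3) (.reg 4)) (.reg 1)

/-- Put the rank to beat by moving right into register `10`. -/
def setThreshold : Program :=
  .seq (.assign 10 (.reg 0)) <|
  .branch (.reg 1) (.reg 2)
    (.branch (.get 8 (.reg 1)) (.add (.get 9 (.reg 3)) (.lit 1))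
      (.assign 10 (rankExpr (.get 9 (.reg 3)))) .skip)
    .skip

/-- Skip the targets that are worse than the first hole. Register `11` is set to `0` in order to
leave the loop. -/
def skipTargets : Program :=
  .seq (.assign 11 (.add (.get 7 (.reg 1)) (.lit 1))) <|
  .loop (.reg 4) (.reg 11) <|
    .branch (.reg 10) (rankExpr (.reg 4))
      (.seq (.store 9 queueEnd (.reg 4)) (.assign 4 (.add (.reg 4) (.lit 1))))
      (.assign 11 (.lit 0))

/-- Test whether agent `k` can move to the target in register `4`; the answer is put into register
`12`. The later agents (register `7`) take the first hole (cell of register `6`) if they can, and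
otherwise move right just beyond the assigned positions (register `8`), until no hole is left. -/
def testTarget : Program :=
  .seq (.assign 12 (.lit 0)) <|
  .branch (.reg 4) (.add (.get 7 (.reg 1)) (.lit 1))
    (.seq (.assign 12 (.lit 1)) <|
    .seq (.assign 6 (.reg 3)) <|
    .seq (.assign 7 (.add (.reg 1) (.lit 1))) <|
    .seq (.assign 8 (.add (.reg 4) (.lit 1))) <|
    .seq (.assign 9 queueEnd) <|
    .loop (.reg 6) (.reg 9) <|
      .seq (.branch (.get 8 (.reg 7)) (.add (.get 9 (.reg 6)) (.lit 1))
        (.assign 6 (.add (.reg 6) (.lit 1)))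
        (.branch (.reg 8) (.add (.get 7 (.reg 7)) (.lit 1))
          (.assign 8 (.add (.reg 8) (.lit 1)))
          (.seq (.assign 12 (.lit 0)) (.assign 6 (.reg 9))))) <|
      .assign 7 (.add (.reg 7) (.lit 1)))
    .skip

/-- Accept the target in register `4` and turn to the next one. -/
def acceptTarget : Program :=
  .seq (.store 9 queueEnd (.reg 4)) <|
  .seq (.assign 4 (.add (.reg 4) (.lit 1))) <|
  .assign 5 (.lit 1)

/-- Agent `k` moves to the last accepted target. -/
def pushAgent : Program :=
  .seq (.store 3 (.get 5 (.get 4 (.reg 1))) (.get 4 (.sub (.reg 4) (.lit 1)))) <|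
  .seq (.assign 2 (.reg 4)) <|
  .seq (.assign 5 (.lit 0)) <|
  .assign 1 (.add (.reg 1) (.lit 1))

/-- Agent `k` takes the first hole. -/
def popAgent : Program :=
  .seq (.store 3 (.get 5 (.get 4 (.reg 1))) (.get 4 (.get 9 (.reg 3)))) <|
  .seq (.assign 3 (.add (.reg 3) (.lit 1))) <|
  .seq (.assign 4 (.reg 2)) <|
  .assign 1 (.add (.reg 1) (.lit 1))

/-- Serial dictatorship along the path. -/
def dictate : Program :=
  .seq (.assign 1 (.lit 0)) <|
  .seq (.assign 2 (.lit 0)) <|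
  .seq (.assign 3 (.lit 0)) <|
  .seq (.assign 4 (.lit 0)) <|
  .seq (.assign 5 (.lit 0)) <|
  .loop (.reg 1) (.reg 0) <|
    .seq setThreshold <|
    .seq skipTargets <|
    .seq testTarget <|
    .branch (.lit 0) (.reg 12) acceptTarget <|
      .branch (.lit 0) (.reg 5) pushAgent popAgent

section Dictate

variable {W n : ℕ} {r : ℕ → ℕ → ℕ} {L R p g f : ℕ → ℕ} {s : Store}

theorem setThreshold_spec (hW : 10 * (n * n) + 10 ≤ W) (hT : Tables n r p g s)
    (hL : IsWalkRange n r L R) (h8 : s.arr 8 = L) (hk : s.reg 1 < n)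
    (hI : SearchInv n r L R (s.arr 9) f (s.reg 1) (s.reg 2) (s.reg 3) (s.reg 4) (s.reg 5)) :
    Tri W setThreshold s fun t s' => t ≤ 30 ∧
      s'.reg 10 = threshold n r L (s.arr 9) (s.reg 1) (s.reg 2) (s.reg 3) := by
  have hnn : n ≤ n * n := Nat.le_mul_self n
  have h1 := hI.bound_le
  have h2 := hI.le_size
  have h3 := hI.hd_le
  have h4 := hL.left_le _ hk
  simp only [setThreshold, tri_seq, tri_assign, tri_branch, tri_skip, Expr.Fits, Expr.eval,
    Expr.cost, Store.setReg_reg, Store.setReg_arr, ↓reduceIte, Nat.reduceEqDiff, hT.size, h8,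
    OfNat.one_ne_ofNat]
  refine ⟨by omega, by omega, by omega, fun h5 => ?_, fun h5 => ?_⟩
  · have h6 := hI.first_lt h5
    have h7 : s.arr 9 (s.reg 3) < n := by omega
    have a1 := hT.path_lt _ hk
    have a2 := hT.agent_lt _ hk
    have a3 := index_lt (hT.agent_lt _ hk) (hT.path_lt _ h7)
    have a4 := hT.path_lt _ h7
    have a5 := hT.rank_lt _ hk _ h7
    simp only [hT.path _ hk, hT.agent _ hk, hT.path _ h7, hT.rank _ hk _ h7]
    refine ⟨by omega, by omega, fun h8 => ⟨by omega, by omega, ?_⟩, fun h8 => ⟨by omega, ?_⟩⟩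
    · exact (if_pos ⟨h5, by omega⟩).symm
    · exact (if_neg (by omega)).symm
  · exact ⟨by omega, (if_neg (by tauto)).symm⟩

/-- Skipping keeps the invariant, and stops at a target that is out of range or not worse than the
first hole. If agent `k` is already committed, then no target is skipped. -/
theorem skipTargets_spec (hW : 10 * (n * n) + 10 ≤ W) (hT : Tables n r p g s)
    (hL : IsWalkRange n r L R) (h7 : s.arr 7 = R) (hk : s.reg 1 < n)
    (hI : SearchInv n r L R (s.arr 9) f (s.reg 1) (s.reg 2) (s.reg 3) (s.reg 4) (s.reg 5))
    (h10 : s.reg 10 = threshold n r L (s.arr 9) (s.reg 1) (s.reg 2) (s.reg 3)) :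
    Tri W skipTargets s fun t s' => t ≤ 150 * n ∧ s.reg 4 ≤ s'.reg 4 ∧
      SearchInv n r L R (s'.arr 9) f (s.reg 1) (s.reg 2) (s.reg 3) (s'.reg 4) (s.reg 5) ∧
      (s'.reg 4 ≤ R (s.reg 1) → ¬ threshold n r L (s'.arr 9) (s.reg 1) (s.reg 2) (s.reg 3) <
        r (s.reg 1) (s'.reg 4)) := by
  have hnn : n ≤ n * n := Nat.le_mul_self n
  have hR := hL.right_lt _ hk
  have hth : s.reg 10 ≤ n := by
    rw [h10, threshold]
    split_ifs with h
    · have := hI.first_lt h.1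
      have := hI.bound_le
      have := hI.le_size
      exact (hT.rank_lt _ hk _ (by omega)).le
    · exact le_rfl
  simp only [skipTargets, tri_seq, tri_assign, Expr.Fits, Expr.eval, Expr.cost, h7]
  refine ⟨by omega, ?_⟩
  refine tri_loop (fun m s' => m = (if s'.reg 11 = 0 then 0 else n + 1 - s'.reg 4) ∧
      SearchInv n r L R (s'.arr 9) f (s.reg 1) (s.reg 2) (s.reg 3) (s'.reg 4) (s.reg 5) ∧
      threshold n r L (s'.arr 9) (s.reg 1) (s.reg 2) (s.reg 3) = s.reg 10 ∧
      (s'.reg 11 = R (s.reg 1) + 1 ∨ s'.reg 11 = 0 ∧ ¬ s.reg 10 < r (s.reg 1) (s'.reg 4)) ∧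
      s.reg 4 ≤ s'.reg 4)
      40 (n + 1 - s.reg 4) ?_ ?_ ?_
  · simp only [Store.setReg_reg, Store.setReg_arr, ↓reduceIte, Nat.reduceEqDiff]
    exact ⟨trivial, hI, h10.symm, .inl trivial, le_rfl⟩
  · rintro m s₁ hf ⟨h1, h2, h3, h4, h4b⟩
    have T₁ : Tables n r p g s₁ := hT.congr (by rw [hf.reg 0 (by decide)]; simp)
      (by rw [hf.arr 4 (by decide)]; simp) (by rw [hf.arr 5 (by decide)]; simp)
      (by rw [hf.arr 6 (by decide)]; simp)
    have f1 : s₁.reg 1 = s.reg 1 := by rw [hf.reg 1 (by decide)]; simp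
    have f3 : s₁.reg 3 = s.reg 3 := by rw [hf.reg 3 (by decide)]; simp
    have f10 : s₁.reg 10 = s.reg 10 := by rw [hf.reg 10 (by decide)]; simp
    have h5 := h2.le_size
    have h6 := h2.hd_le
    simp only [tri_seq, tri_assign, tri_branch, tri_store, Expr.Fits, Expr.eval, Expr.cost,
      f1, f3, f10, T₁.size]
    refine ⟨by omega, by omega, fun hlt => ?_⟩
    have h4' : s₁.reg 11 = R (s.reg 1) + 1 := by omega
    have hb : s₁.reg 4 < n := by omega
    have a1 := hT.path_lt _ hk
    have a2 := hT.agent_lt _ hk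
    have a3 := index_lt (hT.agent_lt _ hk) (hT.path_lt _ hb)
    have a4 := hT.path_lt _ hb
    have a5 := hT.rank_lt _ hk _ hb
    rw [if_neg (by omega)] at h1
    simp only [T₁.path _ hk, T₁.agent _ hk, T₁.path _ hb, T₁.rank _ hk _ hb, Store.setReg_reg,
      Store.setArr_reg, Store.setReg_arr, Store.setArr_arr, ↓reduceIte, Nat.reduceEqDiff]
    refine ⟨by omega, by omega, fun h8 => ?_, fun h8 => ?_⟩
    · refine ⟨by omega, by omega, by omega, by omega, n + 1 - (s₁.reg 4 + 1), by omega, ?_,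
        h2.skip hL hk (by omega) (by omega), ?_, .inl h4', by omega⟩
      · rw [if_neg (by omega)]
      · rw [h2.threshold_update, h3]
    · exact ⟨by omega, by omega, 0, by omega, rfl, h2, h3, .inr ⟨trivial, h8⟩, h4b⟩
  · rintro t s' m ht hf ⟨h1, h2, h3, h4, h4b⟩ hc
    simp only [Expr.eval, Expr.cost] at hc ht
    have e : (n + 1 - s.reg 4 + 1) * (40 + (1 + 1 + 1)) ≤ (n + 2) * 43 :=
      Nat.mul_le_mul_right _ (by omega)
    refine ⟨by omega, h4b, h2, fun h5 => ?_⟩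
    rw [h3]
    rcases h4 with h4 | h4
    · omega
    · exact h4.2

/-- The test simulates the greedy completion: the current state of the simulation is completable if
and only if the state after moving agent `k` to the target is. -/
theorem testTarget_spec (hn : 0 < n) (hW : 10 * (n * n) + 10 ≤ W) (hL : IsWalkRange n r L R)
    (h7 : s.arr 7 = R) (h8 : s.arr 8 = L) (hk : s.reg 1 < n)
    (hI : SearchInv n r L R (s.arr 9) f (s.reg 1) (s.reg 2) (s.reg 3) (s.reg 4) (s.reg 5)) :
    Tri W testTarget s fun t s' => t ≤ 150 * n ∧ s'.reg 12 ≤ 1 ∧ (0 < s'.reg 12 ↔ s.reg 4 ≤ R (s.reg 1) ∧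
      Completable n L R (s.reg 1 + 1)
        (holes (s.arr 9) (s.reg 3) (s.reg 3 + s.reg 4 - s.reg 1), s.reg 4 + 1)) := by
  have hnn : n ≤ n * n := Nat.le_mul_self n
  have hR := hL.right_lt _ hk
  have i1 := hI.le_bound
  have i2 := hI.bound_le
  have i3 := hI.le_size
  have i4 := hI.hd_le
  simp only [testTarget, tri_seq, tri_assign, tri_branch, tri_skip, Expr.Fits, Expr.eval,
    Expr.cost, Store.setReg_reg, Store.setReg_arr, ↓reduceIte, Nat.reduceEqDiff, h7,
    OfNat.one_ne_ofNat]
  refine ⟨by omega, by omega, by omega, fun hb => ?_, fun hb => ⟨by omega, by omega, ?_⟩⟩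
  swap
  · simp only [lt_self_iff_false, false_iff]
    intro h; omega
  refine ⟨by omega, by omega, by omega, by omega, by omega, ?_⟩
  generalize hE : s.reg 3 + s.reg 4 - s.reg 1 = E
  have hwf : LineState.WF (holes (s.arr 9) (s.reg 3) E, s.reg 4 + 1) (s.reg 1 + 1) := by
    have h1 := LineStep.push (L := L) (Q := holes (s.arr 9) (s.reg 3) (s.reg 3 + s.reg 2 - s.reg 1))
      i2 (Nat.le_of_lt_succ hb)
    rw [← hI.holes_eq i2 le_rfl, hE] at h1
    exact h1.wf hI.chain.wf
  refine tri_loop (fun m s' => m + s'.reg 7 = n ∧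
      (s'.reg 12 = 1 ∧ s'.reg 6 ≤ E ∧ E + s'.reg 7 = s'.reg 8 + s'.reg 6 ∧ s'.reg 8 ≤ n ∧
        LineState.WF (holes (s.arr 9) (s'.reg 6) E, s'.reg 8) (s'.reg 7) ∧
        (Completable n L R (s'.reg 7) (holes (s.arr 9) (s'.reg 6) E, s'.reg 8) ↔
          Completable n L R (s.reg 1 + 1) (holes (s.arr 9) (s.reg 3) E, s.reg 4 + 1)) ∨
      s'.reg 12 = 0 ∧ s'.reg 6 = E ∧
        ¬ Completable n L R (s.reg 1 + 1) (holes (s.arr 9) (s.reg 3) E, s.reg 4 + 1)))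
      30 (n - (s.reg 1 + 1)) ?_ ?_ ?_
  · simp only [Store.setReg_reg, ↓reduceIte, Nat.reduceEqDiff]
    exact ⟨by omega, .inl ⟨trivial, by omega, by omega, by omega, hwf, trivial⟩⟩
  · rintro m s₁ hf ⟨h1, h2⟩
    have f7 : s₁.arr 7 = R := by rw [hf.arr 7 (by decide)]; simp [h7]
    have f8 : s₁.arr 8 = L := by rw [hf.arr 8 (by decide)]; simp [h8]
    have f9 : s₁.arr 9 = s.arr 9 := by rw [hf.arr 9 (by decide)]; simp
    have g9 : s₁.reg 9 = E := by rw [hf.reg 9 (by decide)]; simp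
    simp only [tri_seq, tri_assign, tri_branch, Expr.Fits, Expr.eval, Expr.cost, f7, f8, f9, g9]
    refine ⟨by omega, by omega, fun hlt => ?_⟩
    rcases h2 with ⟨h3, h4, h5, h6, hw, hiff⟩ | h2
    swap
    · omega
    have hj : s₁.reg 7 < n := by omega
    have b1 := hL.left_le _ hj
    have b2 := hL.right_lt _ hj
    rw [holes_cons hlt] at hw hiff
    have b3 := hw.lt (s.arr 9 (s₁.reg 6)) (by simp)
    simp only at b3
    simp only [Store.setReg_reg, ↓reduceIte, Nat.reduceEqDiff]
    refine ⟨by omega, by omega, fun h9 => ?_, fun h9 => ⟨by omega, by omega, fun h10 => ?_,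
      fun h10 => ?_⟩⟩
    · rw [completable_cons_iff_pop hL.le_right hj hw (by omega)] at hiff
      refine ⟨by omega, by omega, by omega, m - 1, by omega, by omega, .inl ⟨h3, by omega,
        by omega, by omega, ?_, hiff⟩⟩
      exact LineStep.wf (L := L) (R := R) (.pop (by omega)) hw
    · rw [completable_cons_iff_push hL.le_right hj hw (by omega)] at hiff
      refine ⟨by omega, by omega, by omega, m - 1, by omega, by omega, .inl ⟨h3, by omega,
        by omega, by omega, ?_, ?_⟩⟩
      · have := LineStep.wf (L := L) (R := R) (.push le_rfl (Nat.le_of_lt_succ h10)) hw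
        rw [holes_cons hlt]
        simpa using this
      · rw [holes_cons hlt, ← hiff]
        exact ⟨fun h => ⟨by omega, h⟩, fun h => h.2⟩
    · rw [completable_cons_iff_push hL.le_right hj hw (by omega)] at hiff
      refine ⟨by omega, by omega, by omega, by omega, m - 1, by omega, by omega,
        .inr ⟨trivial, g9, ?_⟩⟩
      rw [← hiff]
      omega
  · rintro t s' m ht hf ⟨h1, h2⟩ hc
    have g9 : s'.reg 9 = E := by rw [hf.reg 9 (by decide)]; simp
    simp only [Expr.eval, Expr.cost, g9] at hc ht
    have e : (n - (s.reg 1 + 1) + 1) * (30 + (1 + 1 + 1)) ≤ n * 33 :=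
      Nat.mul_le_mul_right _ (by omega)
    refine ⟨by omega, by omega, ?_⟩
    rcases h2 with ⟨h3, h4, h5, h6, hw, hiff⟩ | ⟨h3, h4, h5⟩
    · rw [holes_of_le (by omega), show s'.reg 8 = s'.reg 7 by omega] at hiff
      exact ⟨fun _ => ⟨by omega, hiff.1 (completable_nil hL.le_right (by omega))⟩,
        fun _ => by omega⟩
    · exact ⟨fun _ => by omega, fun h => absurd h.2 h5⟩

/-- Each round lowers `(n - k) + (n - m)` resp., once agent `k` is committed to move right,
`(n - k) + (n - b)`. So there are at most `2 n` rounds, of `O(n)` steps each. -/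
theorem dictate_spec (hn : 0 < n) (hW : 10 * (n * n) + 10 ≤ W) (hT : Tables n r p g s)
    (hg : ∀ k < n, ∀ l < n, g k = g l → k = l)
    (hinj : ∀ k < n, ∀ x < n, ∀ y < n, r k x = r k y → x = y)
    (hL : IsWalkRange n r L R) (h7 : s.arr 7 = R) (h8 : s.arr 8 = L) :
    Tri W dictate s fun t s' => t ≤ 2000 * (n * n) ∧ ∃ f S, LineChain L R f n S ∧
      IsBestChain n r L R f n ∧ ∀ k < n, s'.arr 3 (g k) = p (f k) := by
  have hnn : n ≤ n * n := Nat.le_mul_self n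
  simp only [dictate, tri_seq, tri_assign, Expr.Fits, Expr.eval, Expr.cost]
  refine ⟨by omega, by omega, by omega, by omega, by omega, ?_⟩
  refine tri_loop (fun m s' => ∃ f,
      SearchInv n r L R (s'.arr 9) f (s'.reg 1) (s'.reg 2) (s'.reg 3) (s'.reg 4) (s'.reg 5) ∧
      m = (n - s'.reg 1) + (n - if s'.reg 5 = 0 then s'.reg 2 else s'.reg 4) ∧
      ∀ k < s'.reg 1, s'.arr 3 (g k) = p (f k)) (500 * n) (2 * n) ?_ ?_ ?_
  · simp only [Store.setReg_reg, Store.setReg_arr, ↓reduceIte, Nat.reduceEqDiff,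
      OfNat.one_ne_ofNat]
    exact ⟨fun _ => 0, .init hL, by omega, fun k hk => by omega⟩
  · rintro m s₁ hf ⟨f, hI, hm, hout⟩
    have T₁ : Tables n r p g s₁ := hT.congr (by rw [hf.reg 0 (by decide)]; simp)
      (by rw [hf.arr 4 (by decide)]; simp) (by rw [hf.arr 5 (by decide)]; simp)
      (by rw [hf.arr 6 (by decide)]; simp)
    have f7 : s₁.arr 7 = R := by rw [hf.arr 7 (by decide)]; simp [h7]
    have f8 : s₁.arr 8 = L := by rw [hf.arr 8 (by decide)]; simp [h8]
    simp only [tri_seq, Expr.Fits, Expr.eval, T₁.size]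
    have i0 := hI.k_le
    refine ⟨by omega, by omega, fun hk => ?_⟩
    have hR := hL.right_lt _ hk
    refine (setThreshold_spec hW T₁ hL f8 hk hI).frame.imp fun t₂ s₂ ⟨⟨ht₂, h10⟩, hf₂⟩ => ?_
    have T₂ : Tables n r p g s₂ := T₁.congr (hf₂.reg 0 (by decide)) (hf₂.arr 4 (by decide))
      (hf₂.arr 5 (by decide)) (hf₂.arr 6 (by decide))
    simp only [← hf₂.arr 9 (by decide), ← hf₂.arr 3 (by decide), ← hf₂.reg 1 (by decide),
      ← hf₂.reg 2 (by decide), ← hf₂.reg 3 (by decide), ← hf₂.reg 4 (by decide),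
      ← hf₂.reg 5 (by decide)] at hI hm hout hk hR h10
    rw [← hf₂.arr 7 (by decide)] at f7
    rw [← hf₂.arr 8 (by decide)] at f8
    refine (skipTargets_spec hW T₂ hL f7 hk hI h10).frame.imp
      fun t₃ s₃ ⟨⟨ht₃, hb₃, hI₃, hbeat⟩, hf₃⟩ => ?_
    have T₃ : Tables n r p g s₃ := T₂.congr (hf₃.reg 0 (by decide)) (hf₃.arr 4 (by decide))
      (hf₃.arr 5 (by decide)) (hf₃.arr 6 (by decide))
    simp only [← hf₃.arr 3 (by decide), ← hf₃.reg 1 (by decide), ← hf₃.reg 2 (by decide),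
      ← hf₃.reg 3 (by decide), ← hf₃.reg 5 (by decide)] at hI₃ hm hout hk hR hbeat
    rw [← hf₃.arr 7 (by decide)] at f7
    rw [← hf₃.arr 8 (by decide)] at f8
    refine (testTarget_spec hn hW hL f7 f8 hk hI₃).frame.imp fun t₄ s₄ ⟨⟨ht₄, h12, htest⟩, hf₄⟩ => ?_
    have T₄ : Tables n r p g s₄ := T₃.congr (hf₄.reg 0 (by decide)) (hf₄.arr 4 (by decide))
      (hf₄.arr 5 (by decide)) (hf₄.arr 6 (by decide))
    simp only [← hf₄.arr 9 (by decide), ← hf₄.arr 3 (by decide), ← hf₄.reg 1 (by decide),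
      ← hf₄.reg 2 (by decide), ← hf₄.reg 3 (by decide), ← hf₄.reg 4 (by decide),
      ← hf₄.reg 5 (by decide)] at hI₃ hm hout hk hR hbeat htest hb₃
    -- from here on everything is expressed in terms of the store `s₄` after the test
    have h1 := hI₃.hd_le
    have h2 := hI₃.le_bound
    have h3 := hI₃.bound_le
    have h4 := hI₃.le_size
    have h5 := hI₃.flag_le
    have a1 := hT.path_lt _ hk
    have a2 := hT.agent_lt _ hk
    have hupd : ∀ w k, k < s₄.reg 1 + 1 →
        Function.update (s₄.arr 3) (g (s₄.reg 1)) (p w) (g k) =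
          p (Function.update f (s₄.reg 1) w k) := by
      intro w k hk'
      simp only [Function.update_apply]
      rcases Nat.lt_succ_iff_lt_or_eq.1 hk' with h5 | rfl
      · rw [if_neg fun h => by have := hg _ (by omega) _ hk h; omega, if_neg (by omega),
          hout k h5]
      · simp
    simp only [tri_branch, Expr.Fits, Expr.eval, Expr.cost]
    refine ⟨by omega, by omega, fun hok => ?_, fun hok => ⟨by omega, by omega, fun hc => ?_,
      fun hc => ?_⟩⟩
    · obtain ⟨h5, h6⟩ := htest.1 hok
      have h7 := hI₃.accept hL hinj T₄.rank_lt hk h5 (hbeat h5) h6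
      simp only [acceptTarget, tri_seq, tri_assign, tri_store, Expr.Fits, Expr.eval, Expr.cost,
        Store.setReg_reg, Store.setArr_reg, Store.setReg_arr, Store.setArr_arr, ↓reduceIte,
        Nat.reduceEqDiff, OfNat.one_ne_ofNat]
      refine ⟨by omega, by omega, by omega, by omega, by omega, _, ?_, f, h7, rfl, hout⟩
      split_ifs at hm <;> omega
    · have hfail : ¬ _ := fun h => hok (htest.2 h)
      obtain ⟨h5, h6⟩ := hI₃.push hL (by omega) hk hfail
      have hv : s₄.reg 4 - 1 < n := by omega
      have a3 := hT.path_lt _ hv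
      simp only [pushAgent, tri_seq, tri_assign, tri_store, Expr.Fits, Expr.eval, Expr.cost,
        Store.setReg_reg, Store.setArr_reg, Store.setReg_arr, Store.setArr_arr, ↓reduceIte,
        Nat.reduceEqDiff, OfNat.one_ne_ofNat, T₄.path _ hk, T₄.agent _ hk, T₄.path _ hv]
      refine ⟨by omega, by omega, by omega, by omega, by omega, by omega, _, ?_, _, h6, rfl,
        hupd _⟩
      rw [if_neg (by omega)] at hm
      omega
    · have hfail : ¬ _ := fun h => hok (htest.2 h)
      have hc' : s₄.reg 5 = 0 := by omega
      rw [hc'] at hI₃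
      obtain ⟨h5, h6⟩ := hI₃.pop hL T₄.rank_lt hk hfail
      have h7 := hI₃.first_lt h5
      have hv : s₄.arr 9 (s₄.reg 3) < n := by omega
      have a3 := hT.path_lt _ hv
      simp only [popAgent, tri_seq, tri_assign, tri_store, Expr.Fits, Expr.eval, Expr.cost,
        Store.setReg_reg, Store.setArr_reg, Store.setReg_arr, Store.setArr_arr, ↓reduceIte,
        Nat.reduceEqDiff, OfNat.one_ne_ofNat, T₄.path _ hk, T₄.agent _ hk, T₄.path _ hv, hc']
      refine ⟨by omega, by omega, by omega, by omega, by omega, by omega, _, ?_, _, h6, rfl,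
        hupd _⟩
      rw [if_pos hc'] at hm
      omega
  · rintro t s' m ht hf ⟨f, hI, hm, hout⟩ hc
    have f0 : s'.reg 0 = n := by rw [hf.reg 0 (by decide)]; simpa using hT.size
    simp only [Expr.eval, Expr.cost, f0] at hc ht
    have hkn : s'.reg 1 = n := by have := hI.k_le; omega
    refine ⟨?_, f, _, hkn ▸ hI.chain, hkn ▸ hI.best, fun k hk => hout k (by omega)⟩
    have e : (2 * n + 1) * (500 * n + (1 + 1 + 1)) = 1000 * (n * n) + 506 * n + 3 := by ring
    omega

end Dictate

/-! ### The algorithm -/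

namespace SimpleGraph

/-- Reversal of a path. -/
def pathGraphRev (n : ℕ) : pathGraph n ≃g pathGraph n where
  toEquiv := Fin.revPerm
  map_rel_iff' := by
    intro a b
    simp only [pathGraph_adj, Fin.revPerm_apply, Fin.val_rev]
    omega

variable {n : ℕ} {G : SimpleGraph (Fin n)} {w : ℕ → ℕ → ℕ}

/-- A path has a vertex with at most one neighbour. -/
theorem exists_endpoint (hn : 0 < n) (e : pathGraph n ≃g G)
    (hadj : ∀ b b' : Fin n, G.Adj b b' → w b b' = 1)
    (hnadj : ∀ b b' : Fin n, ¬ G.Adj b b' → w b b' = 0) :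
    ∃ b < n, ∑ j ∈ Finset.range n, w b j < 2 := by
  refine ⟨e ⟨0, hn⟩, Fin.is_lt _, ?_⟩
  let c : ℕ := if h : 1 < n then e ⟨1, h⟩ else 0
  have h1 : ∀ j ∈ Finset.range n, w (e ⟨0, hn⟩) j ≤ if j = c then 1 else 0 := by
    intro j hj
    rw [Finset.mem_range] at hj
    obtain ⟨k, hk⟩ := e.surjective ⟨j, hj⟩
    have hkj : (e k : ℕ) = j := by rw [hk]
    rw [← hkj]
    by_cases h2 : G.Adj (e ⟨0, hn⟩) (e k)
    · rw [hadj _ _ h2, if_pos]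
      rw [e.map_rel_iff, pathGraph_adj] at h2
      have hk1 : (k : ℕ) = 1 := by simp only at h2; omega
      have hn1 : 1 < n := by have := k.2; omega
      have : k = ⟨1, hn1⟩ := Fin.ext hk1
      simp only [c, dif_pos hn1, this]
    · rw [hnadj _ _ h2]; exact Nat.zero_le _
  have h2 := Finset.sum_le_sum h1
  rw [Finset.sum_ite_eq'] at h2
  split_ifs at h2 <;> omega

/-- Conversely, a path can be traversed from each such vertex. -/
theorem exists_iso_zero_eq (hn : 0 < n) (e : pathGraph n ≃g G)
    (hadj : ∀ b b' : Fin n, G.Adj b b' → w b b' = 1) (b : Fin n)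
    (hb : ∑ j ∈ Finset.range n, w b j < 2) : ∃ e' : pathGraph n ≃g G, e' ⟨0, hn⟩ = b := by
  obtain ⟨k, rfl⟩ := e.surjective b
  by_cases h0 : (k : ℕ) = 0
  · exact ⟨e, congrArg e (Fin.ext h0.symm)⟩
  by_cases hlast : (k : ℕ) + 1 = n
  · refine ⟨(pathGraphRev n).trans e, congrArg e (Fin.ext ?_)⟩
    change (Fin.rev ⟨0, hn⟩ : Fin n).val = k
    rw [Fin.val_rev]; simp only; omega
  · -- an inner vertex has two neighbours
    exfalso
    let x : Fin n := ⟨k - 1, by omega⟩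
    let y : Fin n := ⟨k + 1, by have := k.2; omega⟩
    have hx : G.Adj (e k) (e x) := by
      rw [e.map_rel_iff, pathGraph_adj]; right; simp only [x]; omega
    have hy : G.Adj (e k) (e y) := by
      rw [e.map_rel_iff, pathGraph_adj]; left; simp only [y]
    have hxy : (e x : ℕ) ≠ e y := fun h => by
      have := e.injective (Fin.ext h)
      simp only [x, y, Fin.mk.injEq] at this
      omega
    have h1 : ∑ j ∈ {(e x : ℕ), (e y : ℕ)}, w (e k) j ≤ ∑ j ∈ Finset.range n, w (e k) j := by
      refine Finset.sum_le_sum_of_subset fun j hj => ?_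
      rw [Finset.mem_insert, Finset.mem_singleton] at hj
      rw [Finset.mem_range]
      rcases hj with rfl | rfl <;> exact Fin.is_lt _
    rw [Finset.sum_pair hxy, hadj _ _ hx, hadj _ _ hy] at h1
    omega

end SimpleGraph

/-- The algorithm: tabulate the ranks, list the path from one end to the other, compute the walk
ranges, and run serial dictatorship. -/
def paretoProgram : Program :=
  .seq tabulate <| .seq findEndpoint <| .seq listPath <| .seq walkRanges dictate

theorem mainTheorem2 :
    ∃ (P : Program) (C : ℕ), ∀ (n : ℕ), 0 < n →
      ∀ (F : OAF (Fin n) (Fin n)) (μ₀ : Fin n ≃ Fin n),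
        Nonempty (SimpleGraph.pathGraph n ≃g F.graph) →
        ∀ s : Store, IsInput F μ₀ s →
          ∃ (t : ℕ) (s' : Store) (μ : Fin n ≃ Fin n),
            Exec (C * n ^ 2) P s t s' ∧ t ≤ C * n ^ 2 ∧ IsOutput s' μ ∧
            F.IsParetoEfficient μ₀ μ ∧
            ∃ e : SimpleGraph.pathGraph n ≃g F.graph,
              F.IsSerialDictatorship μ₀ (e.toEquiv.trans μ₀.symm) μ := by
  -- the parts take at most `200 + 200 + 200 + 400 + 2000 = 3000` times `n ^ 2` steps
  refine ⟨paretoProgram, 3000, fun n hn F μ₀ ⟨e₀⟩ s hs => ?_⟩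
  have hnn : n ≤ n * n := Nat.le_mul_self n
  have hW : 10 * (n * n) + 10 ≤ 3000 * n ^ 2 := by rw [pow_two]; omega
  suffices H : Tri (3000 * n ^ 2) paretoProgram s fun t s' => t ≤ 3000 * n ^ 2 ∧
      ∃ μ : Fin n ≃ Fin n, IsOutput s' μ ∧ ∃ e : SimpleGraph.pathGraph n ≃g F.graph,
        F.IsSerialDictatorship μ₀ (e.toEquiv.trans μ₀.symm) μ by
    obtain ⟨t, s', h1, h2, μ, h3, e, h4⟩ := H
    exact ⟨t, s', μ, h1, h2, h3, h4.isParetoEfficient, e, h4⟩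
  -- ranks and initial matching as functions on the natural numbers
  let rk : ℕ → ℕ → ℕ := fun a b => if h : a < n ∧ b < n then F.rank ⟨a, h.1⟩ ⟨b, h.2⟩ else 0
  let mu : ℕ → ℕ := fun a => if h : a < n then μ₀ ⟨a, h⟩ else 0
  have hrk : ∀ a b : Fin n, rk a b = F.rank a b := fun a b => by simp [rk]
  have hmu : ∀ a : Fin n, mu a = μ₀ a := fun a => by simp [mu]
  have hranklt : ∀ a b : Fin n, F.rank a b < n := fun a b => by simpa using F.rank_lt a b
  have hentry : ∀ b < n, ∀ j < n, s.arr 1 (b * n + j) ≤ 1 := fun b hb j hj => by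
    by_cases h : F.graph.Adj ⟨b, hb⟩ ⟨j, hj⟩
    · exact (hs.edges _ _ h).le
    · exact (hs.nonedges _ _ h).le.trans (Nat.zero_le _)
  simp only [paretoProgram, tri_seq]
  refine (tabulate_spec (rk := rk) (mu := mu) hn hW hs.size ?_ ?_ ?_ ?_ ?_ ?_).frame.imp
    fun t₁ s₁ ⟨⟨ht₁, h5, h6⟩, hf₁⟩ => ?_
  · intro a ha b hb
    have := hs.prefs ⟨a, ha⟩ ⟨b, hb⟩
    rwa [← hrk] at this
  · intro a ha i hi
    have hinj : Function.Injective fun b : Fin n => (⟨F.rank ⟨a, ha⟩ b, hranklt _ b⟩ : Fin n) :=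
      fun b b' h => F.rank_injective _ (congrArg Fin.val h)
    obtain ⟨b, hb⟩ := Finite.injective_iff_surjective.1 hinj ⟨i, hi⟩
    exact ⟨b, b.2, (hrk ⟨a, ha⟩ b).trans (congrArg Fin.val hb)⟩
  · intro a ha
    exact (hs.initial ⟨a, ha⟩).trans (hmu ⟨a, ha⟩).symm
  · intro a ha
    rw [hmu ⟨a, ha⟩]; exact Fin.is_lt _
  · intro a ha a' ha' h
    rw [hmu ⟨a, ha⟩, hmu ⟨a', ha'⟩] at h
    exact congrArg Fin.val (μ₀.injective (Fin.ext h))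
  · intro a ha b hb
    rw [hrk ⟨a, ha⟩ ⟨b, hb⟩]; exact hranklt _ _
  have g1 : s₁.arr 1 = s.arr 1 := hf₁.arr 1 (by decide)
  have g0 : s₁.reg 0 = n := (hf₁.reg 0 (by decide)).trans hs.size
  refine (findEndpoint_spec hn hW g0 (by rwa [g1]) ?_).frame.imp
    fun t₂ s₂ ⟨⟨ht₂, hlt₂, hend⟩, hf₂⟩ => ?_
  · rw [g1]
    exact SimpleGraph.exists_endpoint (w := fun b j => s.arr 1 (b * n + j)) hn e₀ hs.edges
      hs.nonedges
  rw [g1] at hend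
  obtain ⟨e, he⟩ := SimpleGraph.exists_iso_zero_eq (w := fun b j => s.arr 1 (b * n + j)) hn e₀
    hs.edges ⟨s₂.reg 4, hlt₂⟩ hend
  let p : ℕ → ℕ := fun k => if h : k < n then e ⟨k, h⟩ else 0
  let g : ℕ → ℕ := fun k => if h : k < n then μ₀.symm (e ⟨k, h⟩) else 0
  have hp : ∀ k : Fin n, p k = e k := fun k => by simp [p]
  have hg : ∀ k : Fin n, g k = μ₀.symm (e k) := fun k => by simp [g]
  have hp_lt : ∀ k < n, p k < n := fun k hk => by rw [hp ⟨k, hk⟩]; exact Fin.is_lt _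
  have hg_lt : ∀ k < n, g k < n := fun k hk => by rw [hg ⟨k, hk⟩]; exact Fin.is_lt _
  have hp_inj : ∀ k < n, ∀ l < n, p k = p l → k = l := fun k hk l hl h => by
    rw [hp ⟨k, hk⟩, hp ⟨l, hl⟩] at h
    exact congrArg Fin.val (e.injective (Fin.ext h))
  have g1' : s₂.arr 1 = s.arr 1 := (hf₂.arr 1 (by decide)).trans g1
  have g0' : s₂.reg 0 = n := (hf₂.reg 0 (by decide)).trans g0
  refine (listPath_spec (p := p) hn hW g0' (by rwa [g1']) hp_lt hp_inj ?_ ?_ ?_).frame.imp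
    fun t₃ s₃ ⟨⟨ht₃, hpath⟩, hf₃⟩ => ?_
  · intro b hb
    exact ⟨e.symm ⟨b, hb⟩, Fin.is_lt _, by rw [hp]; simp⟩
  · intro k hk l hl
    rw [hp ⟨k, hk⟩, hp ⟨l, hl⟩, g1']
    have h1 : F.graph.Adj (e ⟨k, hk⟩) (e ⟨l, hl⟩) ↔ k + 1 = l ∨ l + 1 = k := by
      rw [e.map_rel_iff, SimpleGraph.pathGraph_adj]
    rw [← h1]
    by_cases h : F.graph.Adj (e ⟨k, hk⟩) (e ⟨l, hl⟩)
    · rw [hs.edges _ _ h]; simp [h]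
    · rw [hs.nonedges _ _ h]; simp [h]
  · rw [hp ⟨0, hn⟩, he]
  let r : ℕ → ℕ → ℕ := fun k x => rk (g k) (p x)
  have hr : ∀ k x : Fin n, r k x = F.rank (μ₀.symm (e k)) (e x) := fun k x => by
    change rk (g k) (p x) = _
    rw [hg, hp, hrk]
  have hT : Tables n r p g s₃ := by
    refine ⟨(hf₃.reg 0 (by decide)).trans g0', hpath, hp_lt, fun k hk => ?_, hg_lt,
      fun k hk x hx => ?_, fun k hk x hx => ?_⟩
    · rw [hf₃.arr 5 (by decide), hf₂.arr 5 (by decide), ← h5 (g k) (hg_lt k hk),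
        hg ⟨k, hk⟩, hmu, hp ⟨k, hk⟩, Equiv.apply_symm_apply]
    · rw [hf₃.arr 6 (by decide), hf₂.arr 6 (by decide)]
      exact h6 _ (hg_lt k hk) _ (hp_lt x hx)
    · rw [hr ⟨k, hk⟩ ⟨x, hx⟩]; exact hranklt _ _
  refine (walkRanges_spec hn hW hT).frame.imp fun t₄ s₄ ⟨⟨ht₄, hL⟩, hf₄⟩ => ?_
  have hT' : Tables n r p g s₄ := hT.congr (hf₄.reg 0 (by decide)) (hf₄.arr 4 (by decide))
    (hf₄.arr 5 (by decide)) (hf₄.arr 6 (by decide))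
  refine (dictate_spec hn hW hT' ?_ ?_ hL rfl rfl).imp
    fun t₅ s₅ ⟨ht₅, f, S, hc, hbest, hout⟩ => ?_
  · intro k hk l hl h
    rw [hg ⟨k, hk⟩, hg ⟨l, hl⟩] at h
    exact congrArg Fin.val (e.injective (μ₀.symm.injective (Fin.ext h)))
  · intro k hk x hx y hy h
    rw [hr ⟨k, hk⟩ ⟨x, hx⟩, hr ⟨k, hk⟩ ⟨y, hy⟩] at h
    exact congrArg Fin.val (e.injective (F.rank_injective _ h))
  obtain ⟨μ, hμ, hSD⟩ := F.exists_isSerialDictatorship e μ₀ hr hL hc hbest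
  refine ⟨by rw [pow_two]; omega, μ, fun a => ?_, e, hSD⟩
  obtain ⟨k, rfl⟩ : ∃ k, μ₀.symm (e k) = a := ⟨e.symm (μ₀ a), by simp⟩
  have hfk : f k < n :=
    lt_of_le_of_lt (hc.bounds hL.left_le hL.le_right k k.2).2 (hL.right_lt k k.2)
  rw [hμ k ⟨f k, hfk⟩ rfl, ← hg, hout k k.2, ← hp]
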